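/- Let $\Gamma=(V,E,s,r)$ be a finite directed graph and $F$ a field. Paths are written $p=e_1\cdots e_n$ with $r(e_i)=s(e_{i+1})$ (vertices are the paths of length $0$), and $l(p)=n$. The Leavitt path algebra $L(\Gamma)$ is the $F$-algebra generated by $\{v\}_{v\in V}\cup\{e,e^*\}_{e\in E}$ with relations $vw=\delta_{v,w}v$; $s(e)e=e=er(e)$ and $r(e)e^*=e^*=e^*s(e)$; $e^*f=\delta_{e,f}r(e)$; and $v=\sum_{s(e)=v}ee^*$ for every vertex $v$ that is not a sink. It is $\mathbb Z$-graded by $\deg v=0$, $\deg e=1$, $\deg e^*=-1$. For $p=e_1\cdots e_n$ put $p^*=e_n^*\cdots e_1^*$. A specialization is a map $\gamma$ from the set of non-sinks to $E$ with $s(\gamma(v))=v$; the edges in its image are called special, and a path of positive length is special if all its edges are special. Let $\mathrm{sd}(p)$ be the length of the longest final segment of the path $p$ consisting of special edges. For real $n,s,d\ge 0$ let $V_{n,s,d}\subseteq L(\Gamma)$ be the $F$-span of all $pq^*$, $p,q$ paths, with $l(p)+l(q)\ge n$, $\mathrm{sd}(p)+\mathrm{sd}(q)\le s$, $|l(p)-l(q)|\le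 d$, and for $k\ge 1$ let $V_k=\sum\{V_{n,s,d} : n\ge k(s+d+1)\}$. The subspaces $V_k$ form a basis of neighbourhoods of $0$ for an algebra topology on $L(\Gamma)$. Let $\overline{L(\Gamma)}$ be the completion, let $\overline{L(\Gamma)_i}$ be the closure in it of the image of the homogeneous component of degree $i$, and let $\widehat L(\Gamma)=\sum_{i\in\mathbb Z}\overline{L(\Gamma)_i}$, a subalgebra of $\overline{L(\Gamma)}$ with the induced topology (the graded completion). A nonempty $W\subseteq V$ is hereditary if every vertex reachable by a path from a vertex of $W$ lies in $W$. Let $W_1,\dots,W_k$ be the minimal hereditary subsets. The specialization $\gamma$ is regular if (1) there are only finitely many special paths all of whose vertices lie in $V\setminus\bigcup_i W_i$, and (2) for each $i$ the undirected graph with vertex set $W_i$, whose edges are the special edges inside $W_i$ with directions forgotten, is connected. **Statement.** Suppose that $L(\Gamma)$ is prime (it is nonzero, and $IJ\ne 0$ for any nonzero two-sided ideals $I,J$), and let $\gamma$ be a regular specialization on $\Gamma$. Then $\widehat L(\Gamma)$ is topologically graded simple: it is nonzero, and its only closed graded two-sided ideals (closed two-sided ideals $I$ with $I=\sum_i I\cap\overline{L(\Gamma)_i}$)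 are $0$ and $\widehat L(\Gamma)$. -/

import Mathlib

/-- A directed graph with vertex set `V`, edge set `E`, source map `s` and range map `r`. -/
structure DirGraph (V E : Type*) where
  s : E → V
  r : E → V

namespace DirGraph

variable {V E : Type*} (G : DirGraph V E)

/-- A vertex which is not the source of any edge. -/
def IsSink (v : V) : Prop := ∀ e, G.s e ≠ v

/-- `G.IsPath v es w`: the list of edges `es` is a path from `v` to `w`
(the empty list being the path of length `0` at `v = w`). -/
def IsPath : V → List E → V → Prop
  | v, [], w => v = w
  | v, e :: es, w => G.s e = v ∧ IsPath (G.r e) es w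

/-- The paths of `G`; the vertices are the paths of length `0`. -/
structure Path where
  src : V
  edges : List E
  tgt : V
  isPath : G.IsPath src edges tgt

/-- The length of a path. -/
def Path.length {G : DirGraph V E} (p : G.Path) : ℕ := p.edges.length

/-- The list of all vertices lying on a path, both end points included. -/
def Path.vertices {G : DirGraph V E} (p : G.Path) : List V := p.src :: p.edges.map G.r

/-- `G.Descendant v w`: the vertex `w` is a descendant of the vertex `v`. -/
def Descendant (v w : V) : Prop := ∃ p : G.Path, p.src = v ∧ p.tgt = w

/-- Hereditary subsets (nonempty by convention). -/
def IsHereditary (W : Set V) : Prop :=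
  W.Nonempty ∧ ∀ w ∈ W, ∀ u, G.Descendant w u → u ∈ W

/-- The frame of `G`: the set of all minimal hereditary subsets. -/
def frame : Set (Set V) := {W | Minimal G.IsHereditary W}

/-- A specialization chooses for every vertex which is not a sink an edge with this source. -/
structure Specialization where
  toFun : {v : V // ¬ G.IsSink v} → E
  source : ∀ v, G.s (toFun v) = v

variable {G}

/-- The special edges: those in the image of the specialization. -/
def Specialization.IsSpecial (γ : G.Specialization) (e : E) : Prop := e ∈ Set.range γ.toFun

/-- A path of positive length all of whose edges are special. -/
def Specialization.IsSpecialPath (γ : G.Specialization) (p : G.Path) : Prop :=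
  1 ≤ p.length ∧ ∀ e ∈ p.edges, γ.IsSpecial e

open scoped Classical in
/-- The length of the longest final segment consisting of special edges. -/
noncomputable def Specialization.sdList (γ : G.Specialization) (es : List E) : ℕ :=
  (es.rtakeWhile (fun e => decide (γ.IsSpecial e))).length

/-- `sd(p)`: the length of the longest final segment of `p` consisting of special edges. -/
noncomputable def Specialization.sd (γ : G.Specialization) (p : G.Path) : ℕ := γ.sdList p.edges

/-- The undirected graph with vertex set `W` whose edges are the special edges inside `W` with
their directions forgotten (loops and multiplicities play no role for connectedness). -/
def Specialization.undirected (γ : G.Specialization) (W : Set V) : SimpleGraph W :=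
  SimpleGraph.fromRel (fun a b : W => ∃ e, γ.IsSpecial e ∧ G.s e = a ∧ G.r e = b)

/-- Regular specializations. -/
structure Specialization.IsRegular (γ : G.Specialization) : Prop where
  finite_special : {p : G.Path | γ.IsSpecialPath p ∧ ∀ v ∈ p.vertices, v ∉ ⋃₀ G.frame}.Finite
  connected : ∀ W ∈ G.frame, (γ.undirected W).Connected

theorem isPath_append {as bs : List E} : ∀ {v w : V},
    G.IsPath v (as ++ bs) w ↔ ∃ u, G.IsPath v as u ∧ G.IsPath u bs w := by
  induction as with
  | nil => intro v w; simp [IsPath]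
  | cons e es ih => intro v w; simp [IsPath, ih, and_assoc]

theorem isPath_unique {as : List E} : ∀ {v u w : V},
    G.IsPath v as u → G.IsPath v as w → u = w := by
  induction as with
  | nil => intro v u w h h1; exact h.symm.trans h1
  | cons e es ih => intro v u w h h1; exact ih h.2 h1.2

theorem sdList_append_le (γ : G.Specialization) (as bs cs : List E) :
    γ.sdList (as ++ cs) ≤ γ.sdList as + γ.sdList (bs ++ cs) := by
  classical
  have key : ∀ xs : List E, γ.sdList (xs ++ cs) =
      if ∀ c ∈ cs, γ.IsSpecial c then cs.length + γ.sdList xs else γ.sdList cs := by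
    intro xs
    simp only [Specialization.sdList, List.rtakeWhile, List.reverse_append,
      List.takeWhile_append, List.length_reverse (as := List.takeWhile _ _)]
    by_cases h : ∀ c ∈ cs, γ.IsSpecial c
    · have h1 : List.takeWhile (fun e => decide (γ.IsSpecial e)) cs.reverse = cs.reverse := by
        rw [List.takeWhile_eq_self_iff]; simpa using h
      rw [if_pos h, if_pos (by rw [h1])]
      simp [add_comm]
    · have h1 : (List.takeWhile (fun e => decide (γ.IsSpecial e)) cs.reverse).length
          ≠ cs.reverse.length := by
        intro h2
        apply h
        have h3 := (List.takeWhile_prefix (l := cs.reverse)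
          (fun e => decide (γ.IsSpecial e))).eq_of_length h2
        rw [List.takeWhile_eq_self_iff] at h3
        simpa using h3
      rw [if_neg h, if_neg h1, List.length_reverse]
  rw [key as, key bs]
  split_ifs <;> omega

/-! ### The Leavitt path algebra -/

/-- The generators `v`, `e`, `e^*` of the Leavitt path algebra. -/
inductive Gen (V E : Type*)
  | vert (v : V)
  | edge (e : E)
  | ghost (e : E)

/-- `deg v = 0`, `deg e = 1`, `deg e^* = -1`. -/
def Gen.deg : Gen V E → ℤ
  | .vert _ => 0
  | .edge _ => 1
  | .ghost _ => -1

end DirGraph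

namespace DirGraph

variable (F : Type*) [Field F] {V E : Type*} [Fintype V] [Fintype E] (G : DirGraph V E)

open scoped Classical in
/-- The defining relations of the Leavitt path algebra. As the graph is finite, the sum of all
vertices is the identity element; since we present a unital algebra, this is the relation `one`. -/
inductive Rel : FreeAlgebra F (Gen V E) → FreeAlgebra F (Gen V E) → Prop
  | one : Rel (∑ v, FreeAlgebra.ι F (.vert v)) 1
  | vert_mul_self (v : V) : Rel (FreeAlgebra.ι F (.vert v) * FreeAlgebra.ι F (.vert v)) (FreeAlgebra.ι F (.vert v))
  | vert_mul_vert (v w : V) : v ≠ w → Rel (FreeAlgebra.ι F (.vert v) * FreeAlgebra.ι F (.vert w)) 0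
  | source_mul_edge (e : E) : Rel (FreeAlgebra.ι F (.vert (G.s e)) * FreeAlgebra.ι F (.edge e)) (FreeAlgebra.ι F (.edge e))
  | edge_mul_range (e : E) : Rel (FreeAlgebra.ι F (.edge e) * FreeAlgebra.ι F (.vert (G.r e))) (FreeAlgebra.ι F (.edge e))
  | range_mul_ghost (e : E) : Rel (FreeAlgebra.ι F (.vert (G.r e)) * FreeAlgebra.ι F (.ghost e)) (FreeAlgebra.ι F (.ghost e))
  | ghost_mul_source (e : E) : Rel (FreeAlgebra.ι F (.ghost e) * FreeAlgebra.ι F (.vert (G.s e))) (FreeAlgebra.ι F (.ghost e))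
  | ghost_mul_self (e : E) : Rel (FreeAlgebra.ι F (.ghost e) * FreeAlgebra.ι F (.edge e)) (FreeAlgebra.ι F (.vert (G.r e)))
  | ghost_mul_edge (e f : E) : e ≠ f → Rel (FreeAlgebra.ι F (.ghost e) * FreeAlgebra.ι F (.edge f)) 0
  | cuntz_krieger (v : V) : ¬ G.IsSink v →
      Rel (FreeAlgebra.ι F (.vert v)) (∑ e with G.s e = v, FreeAlgebra.ι F (.edge e) * FreeAlgebra.ι F (.ghost e))

/-- The Leavitt path algebra `L(Γ)` of a finite directed graph over the field `F`. -/
abbrev LPA := RingQuot (Rel F G)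

/-- The image of a generator in the Leavitt path algebra. -/
noncomputable def gen (x : Gen V E) : LPA F G := RingQuot.mkAlgHom F (Rel F G) (FreeAlgebra.ι F x)

/-- The homogeneous component `L(Γ)_i`, spanned by the words of degree `i` in the generators. -/
noncomputable def homog (i : ℤ) : Submodule F (LPA F G) :=
  Submodule.span F {x | ∃ l : List (Gen V E),
    (l.map Gen.deg).sum = i ∧ (l.map (gen F G)).prod = x}

variable {G}

/-- The product of a list of edges. -/
noncomputable def fwd (es : List E) : LPA F G := (es.map fun e => gen F G (.edge e)).prod

/-- The product `e_n^* ⋯ e_1^*` for a list of edges `e_1, …, e_n`. -/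
noncomputable def bwd (es : List E) : LPA F G :=
  (es.reverse.map fun e => gen F G (.ghost e)).prod

/-- The element `p` of `L(Γ)` given by a path `p`. -/
noncomputable def Path.el (p : G.Path) : LPA F G := gen F G (.vert p.src) * fwd F p.edges

/-- The element `p^*` of `L(Γ)` given by a path `p`. -/
noncomputable def Path.star (p : G.Path) : LPA F G := bwd F p.edges * gen F G (.vert p.src)

/-- The space `V_{n,s,d}`. -/
noncomputable def Specialization.spaceNSD (γ : G.Specialization) (n s d : ℝ) :
    Submodule F (LPA F G) :=
  Submodule.span F {x | ∃ p q : G.Path, n ≤ p.length + q.length ∧ (γ.sd p + γ.sd q : ℝ) ≤ s ∧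
    |(p.length - q.length : ℝ)| ≤ d ∧ x = p.el F * q.star F}

/-- The space `V_k`, the sum of all `V_{n,s,d}` with `n ≥ k (s + d + 1)`. -/
noncomputable def Specialization.space (γ : G.Specialization) (k : ℝ) : Submodule F (LPA F G) :=
  ⨆ (n : ℝ) (s : ℝ) (d : ℝ) (_ : 0 ≤ n ∧ 0 ≤ s ∧ 0 ≤ d ∧ k * (s + d + 1) ≤ n),
    γ.spaceNSD F n s d

/-! ### The spaces `V_k` define a ring topology -/

section Aux

variable {F}

theorem gen_eq {a b : FreeAlgebra F (Gen V E)} (h : Rel F G a b) :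
    RingQuot.mkAlgHom F (Rel F G) a = RingQuot.mkAlgHom F (Rel F G) b :=
  RingQuot.mkAlgHom_rel F h

theorem vv (v : V) : gen F G (.vert v) * gen F G (.vert v) = gen F G (.vert v) := by
  simpa [gen] using gen_eq (Rel.vert_mul_self (F := F) (G := G) v)

theorem vw {v w : V} (h : v ≠ w) : gen F G (.vert v) * gen F G (.vert w) = 0 := by
  simpa [gen] using gen_eq (Rel.vert_mul_vert (F := F) (G := G) v w h)

theorem se (e : E) : gen F G (.vert (G.s e)) * gen F G (.edge e) = gen F G (.edge e) := by
  simpa [gen] using gen_eq (Rel.source_mul_edge (F := F) (G := G) e)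

theorem er (e : E) : gen F G (.edge e) * gen F G (.vert (G.r e)) = gen F G (.edge e) := by
  simpa [gen] using gen_eq (Rel.edge_mul_range (F := F) (G := G) e)

theorem rg (e : E) : gen F G (.vert (G.r e)) * gen F G (.ghost e) = gen F G (.ghost e) := by
  simpa [gen] using gen_eq (Rel.range_mul_ghost (F := F) (G := G) e)

theorem gs (e : E) : gen F G (.ghost e) * gen F G (.vert (G.s e)) = gen F G (.ghost e) := by
  simpa [gen] using gen_eq (Rel.ghost_mul_source (F := F) (G := G) e)

theorem ge (e : E) : gen F G (.ghost e) * gen F G (.edge e) = gen F G (.vert (G.r e)) := by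
  simpa [gen] using gen_eq (Rel.ghost_mul_self (F := F) (G := G) e)

theorem gf {e f : E} (h : e ≠ f) : gen F G (.ghost e) * gen F G (.edge f) = 0 := by
  simpa [gen] using gen_eq (Rel.ghost_mul_edge (F := F) (G := G) e f h)

theorem fwd_nil : fwd F (G := G) [] = 1 := by simp [fwd]

theorem bwd_nil : bwd F (G := G) [] = 1 := by simp [bwd]

theorem fwd_cons (e : E) (es : List E) :
    fwd F (G := G) (e :: es) = gen F G (.edge e) * fwd F es := by simp [fwd]

theorem bwd_cons (e : E) (es : List E) :
    bwd F (G := G) (e :: es) = bwd F es * gen F G (.ghost e) := by simp [bwd]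

theorem fwd_append (as bs : List E) :
    fwd F (G := G) (as ++ bs) = fwd F as * fwd F bs := by simp [fwd]

theorem bwd_append (as bs : List E) :
    bwd F (G := G) (as ++ bs) = bwd F bs * bwd F as := by simp [bwd]

theorem fwd_tgt {es : List E} : ∀ {v w : V}, G.IsPath v es w →
    gen F G (.vert v) * fwd F es * gen F G (.vert w) = gen F G (.vert v) * fwd F es := by
  induction es with
  | nil => intro v w h; cases h; simp [fwd_nil, vv]
  | cons e es ih =>
    intro v w h
    have := ih h.2
    rw [fwd_cons, ← er, mul_assoc (gen F G (.edge e)), mul_assoc, mul_assoc, this]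

theorem bwd_tgt {es : List E} : ∀ {v w : V}, G.IsPath v es w →
    gen F G (.vert w) * (bwd F es * gen F G (.vert v)) = bwd F es * gen F G (.vert v) := by
  induction es with
  | nil => intro v w h; cases h; simp [bwd_nil, vv]
  | cons e es ih =>
    intro v w h
    have := ih h.2
    rw [bwd_cons, ← rg, ← mul_assoc (bwd F es), ← mul_assoc, ← mul_assoc, this]

theorem bwd_mul_fwd (es : List E) : ∀ (fs : List E) (v w x : V), G.IsPath v es w →
    G.IsPath v fs x →
    bwd F (G := G) es * gen F G (.vert v) * fwd F fs = 0 ∨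
    (∃ hs, fs = es ++ hs ∧
      bwd F (G := G) es * gen F G (.vert v) * fwd F fs = gen F G (.vert w) * fwd F hs) ∨
    (∃ hs, es = fs ++ hs ∧
      bwd F (G := G) es * gen F G (.vert v) * fwd F fs = bwd F hs * gen F G (.vert x)) := by
  induction es with
  | nil =>
    intro fs v w x h h1
    cases h
    exact Or.inr (Or.inl ⟨fs, rfl, by simp [bwd_nil]⟩)
  | cons e es ih =>
    intro fs v w x h h1
    cases fs with
    | nil =>
      cases h1
      exact Or.inr (Or.inr ⟨e :: es, rfl, by simp [fwd_nil]⟩)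
    | cons f fs =>
      obtain ⟨he, h⟩ := h
      obtain ⟨hf, h1⟩ := h1
      subst he
      by_cases hef : e = f
      · subst hef
        have key : bwd F (G := G) (e :: es) * gen F G (.vert (G.s e)) * fwd F (e :: fs)
            = bwd F es * gen F G (.vert (G.r e)) * fwd F fs := by
          rw [bwd_cons, fwd_cons, mul_assoc (bwd F es), gs, mul_assoc,
            ← mul_assoc (gen F G (.ghost e)), ge, mul_assoc]
        rw [key]
        rcases ih fs _ w x h h1 with h2 | ⟨hs, h2, h3⟩ | ⟨hs, h2, h3⟩
        · exact Or.inl h2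
        · exact Or.inr (Or.inl ⟨hs, by simp [h2], h3⟩)
        · exact Or.inr (Or.inr ⟨hs, by simp [h2], h3⟩)
      · left
        rw [bwd_cons, fwd_cons, mul_assoc (bwd F es), gs, mul_assoc,
          ← mul_assoc (gen F G (.ghost e)), gf hef, zero_mul, mul_zero]

/-- The generating set of `V_k`. -/
def Specialization.genSet (F : Type*) [Field F] (γ : G.Specialization) (k : ℝ) : Set (LPA F G) :=
  {x | ∃ p q : G.Path, k * (γ.sd p + γ.sd q + |(p.length - q.length : ℝ)| + 1)
    ≤ p.length + q.length ∧ x = p.el F * q.star F}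

theorem space_eq (γ : G.Specialization) {k : ℝ} (hk : 0 ≤ k) :
    γ.space F k = Submodule.span F (γ.genSet F k) := by
  apply le_antisymm
  · simp only [Specialization.space, iSup_le_iff]
    rintro n s d ⟨-, -, -, h⟩
    rw [Specialization.spaceNSD]
    apply Submodule.span_mono
    rintro x ⟨p, q, h1, h2, h3, rfl⟩
    refine ⟨p, q, ?_, rfl⟩
    have : k * (γ.sd p + γ.sd q + |(p.length - q.length : ℝ)| + 1) ≤ k * (s + d + 1) :=
      mul_le_mul_of_nonneg_left (by linarith) hk
    linarith
  · rw [Submodule.span_le]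
    rintro x ⟨p, q, h1, rfl⟩
    have : γ.spaceNSD F (p.length + q.length) (γ.sd p + γ.sd q) |(p.length - q.length : ℝ)|
        ≤ γ.space F k := by
      rw [Specialization.space]
      exact le_iSup_of_le _ (le_iSup_of_le _ (le_iSup_of_le _ (le_iSup_of_le
        ⟨by positivity, by positivity, by positivity, h1⟩ le_rfl)))
    exact this (Submodule.subset_span ⟨p, q, le_rfl, le_rfl, le_rfl, rfl⟩)

/-- The product of two elements `p q^*` is zero or of the same form, with control of the
parameters. -/
theorem mul_form (γ : G.Specialization) (p q p' q' : G.Path) :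
    p.el F * q.star F * (p'.el F * q'.star F) = 0 ∨ ∃ a b : G.Path,
      p.el F * q.star F * (p'.el F * q'.star F) = a.el F * b.star F ∧
      γ.sd a + γ.sd b ≤ γ.sd p + γ.sd q + (γ.sd p' + γ.sd q') ∧
      (a.length : ℤ) - b.length = p.length - q.length + (p'.length - q'.length) ∧
      p.length + q'.length ≤ a.length + b.length := by
  have e1 : p.el F * q.star F * (p'.el F * q'.star F) =
      p.el F * (bwd F q.edges * (gen F G (.vert q.src) * gen F G (.vert p'.src))
        * fwd F p'.edges) * q'.star F := by
    simp only [Path.el, Path.star, mul_assoc]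
  by_cases hs : q.src = p'.src
  swap
  · left; rw [e1, vw hs]; simp
  rw [← hs, vv] at e1
  rw [e1]
  have hp' := p'.isPath
  rw [← hs] at hp'
  rcases bwd_mul_fwd (F := F) q.edges p'.edges q.src q.tgt p'.tgt q.isPath hp' with
    h | ⟨l, hl, h⟩ | ⟨l, hl, h⟩
  · left; rw [h]; simp
  · rw [h]
    by_cases ht : p.tgt = q.tgt
    swap
    · left
      rw [← mul_assoc, Path.el, ← fwd_tgt p.isPath, mul_assoc (_ * fwd F p.edges), vw ht]
      simp
    right
    rw [hl] at hp'
    obtain ⟨u, hu1, hu2⟩ := isPath_append.1 hp'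
    have hu : q.tgt = u := isPath_unique q.isPath hu1
    refine ⟨⟨p.src, p.edges ++ l, p'.tgt, isPath_append.2 ⟨p.tgt, p.isPath, ?_⟩⟩, q',
      ?_, ?_, ?_, ?_⟩
    · rw [ht, hu]; exact hu2
    · congr 1
      simp only [Path.el]
      rw [show gen F G (.vert q.tgt) = gen F G (.vert p.tgt) by rw [ht], fwd_append, ← mul_assoc, fwd_tgt p.isPath, mul_assoc]
    · have := sdList_append_le γ p.edges q.edges l
      simp only [Specialization.sd, hl]
      omega
    · simp only [Path.length, hl, List.length_append]; push_cast; ring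
    · simp only [Path.length, List.length_append]; omega
  · rw [h]
    by_cases ht : p'.tgt = q'.tgt
    swap
    · left
      rw [mul_assoc, mul_assoc, Path.star, ← bwd_tgt q'.isPath, ← mul_assoc (gen F G (.vert p'.tgt)),
        vw ht]
      simp
    right
    have hq := q.isPath
    rw [hl] at hq
    obtain ⟨u, hu1, hu2⟩ := isPath_append.1 hq
    have hu : p'.tgt = u := isPath_unique hp' hu1
    refine ⟨p, ⟨q'.src, q'.edges ++ l, q.tgt, isPath_append.2 ⟨q'.tgt, q'.isPath, ?_⟩⟩,
      ?_, ?_, ?_, ?_⟩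
    · rw [← ht, hu]; exact hu2
    · rw [mul_assoc]
      congr 1
      simp only [Path.star]
      rw [show gen F G (.vert p'.tgt) = gen F G (.vert q'.tgt) by rw [ht], bwd_append, mul_assoc, bwd_tgt q'.isPath, mul_assoc]
    · have := sdList_append_le γ q'.edges p'.edges l
      simp only [Specialization.sd, hl]
      omega
    · simp only [Path.length, hl, List.length_append]; push_cast; ring
    · simp only [Path.length, List.length_append]; omega

theorem mul_form_real (γ : G.Specialization) (p q p' q' : G.Path) (k : ℝ) (hk : 0 ≤ k)
    (h : 2 * k * (γ.sd p + γ.sd q + (γ.sd p' + γ.sd q') + (|(p.length - q.length : ℝ)| +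
      |(p'.length - q'.length : ℝ)|) + 1) ≤ p.length + q.length + (p'.length + q'.length)
      - |(p.length - q.length : ℝ)| - |(p'.length - q'.length : ℝ)|) :
    p.el F * q.star F * (p'.el F * q'.star F) ∈ γ.space F k := by
  rcases mul_form (F := F) γ p q p' q' with h0 | ⟨a, b, h0, h1, h2, h3⟩
  · rw [h0]; exact Submodule.zero_mem _
  rw [h0, space_eq γ hk]
  refine Submodule.subset_span ⟨a, b, ?_, rfl⟩
  have h1' : (γ.sd a + γ.sd b : ℝ) ≤ γ.sd p + γ.sd q + (γ.sd p' + γ.sd q') := by exact_mod_cast h1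
  have h2' : (a.length - b.length : ℝ) = p.length - q.length + (p'.length - q'.length) := by
    exact_mod_cast h2
  have h3' : (p.length + q'.length : ℝ) ≤ a.length + b.length := by exact_mod_cast h3
  have h4 := abs_add_le (p.length - q.length : ℝ) (p'.length - q'.length)
  have h5 := neg_abs_le (p.length - q.length : ℝ)
  have h6 := le_abs_self (p'.length - q'.length : ℝ)
  rw [← h2'] at h4
  have h7 := mul_le_mul_of_nonneg_left (add_le_add_left (add_le_add h1' h4) 1) hk
  linarith

theorem space_anti (γ : G.Specialization) {k k' : ℝ} (hk : 0 ≤ k) (h : k ≤ k') :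
    γ.space F k' ≤ γ.space F k := by
  rw [space_eq γ hk, space_eq γ (hk.trans h)]
  apply Submodule.span_mono
  rintro x ⟨p, q, h1, rfl⟩
  refine ⟨p, q, le_trans (mul_le_mul_of_nonneg_right h (by positivity)) h1, rfl⟩

theorem space_mul (γ : G.Specialization) {k : ℝ} (hk : 1 ≤ k) :
    ∀ x ∈ γ.space F (2 * k + 1), ∀ y ∈ γ.space F (2 * k + 1), x * y ∈ γ.space F k := by
  rw [space_eq γ (by linarith : 0 ≤ 2 * k + 1)]
  intro x hx y hy
  refine Submodule.span_induction₂ (p := fun x y _ _ => x * y ∈ γ.space F k)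
    ?_ ?_ ?_ ?_ ?_ ?_ ?_ hx hy
  · rintro _ _ ⟨p, q, h, rfl⟩ ⟨p', q', h', rfl⟩
    apply mul_form_real γ p q p' q' k (by linarith)
    have : (0 : ℝ) ≤ γ.sd p + γ.sd q + (γ.sd p' + γ.sd q') := by positivity
    nlinarith
  · intro y _; simp
  · intro x _; simp
  · intro x y z _ _ _ h h'; rw [add_mul]; exact add_mem h h'
  · intro x y z _ _ _ h h'; rw [mul_add]; exact add_mem h h'
  · intro r x y _ _ h; rw [smul_mul_assoc]; exact Submodule.smul_mem _ _ h
  · intro r x y _ _ h; rw [mul_smul_comm]; exact Submodule.smul_mem _ _ h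

/-- Left and right multiplication by `x` are continuous at zero. -/
def MulCont (γ : G.Specialization) (x : LPA F G) : Prop :=
  ∀ k : ℝ, 1 ≤ k → ∃ k', 1 ≤ k' ∧ ∀ y ∈ γ.space F k', x * y ∈ γ.space F k ∧ y * x ∈ γ.space F k

theorem mulCont_monomial (γ : G.Specialization) (p q : G.Path) :
    MulCont γ (p.el F * q.star F) := by
  intro k hk
  set s0 : ℝ := γ.sd p + γ.sd q with hs0
  set d0 : ℝ := |(p.length - q.length : ℝ)| with hd0
  have hs0' : 0 ≤ s0 := by positivity
  have hd0' : 0 ≤ d0 := by positivity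
  have hkk : 0 ≤ 2 * k * (s0 + d0 + 1) := by positivity
  have key : ∀ a b : G.Path, (2 * k * (s0 + d0 + 1) + 1 + d0) *
      (γ.sd a + γ.sd b + |(a.length - b.length : ℝ)| + 1) ≤ a.length + b.length →
      2 * k * (s0 + (γ.sd a + γ.sd b) + (d0 + |(a.length - b.length : ℝ)|) + 1) ≤
        p.length + q.length + (a.length + b.length) - d0 - |(a.length - b.length : ℝ)| := by
    intro a b h
    have h1 : (0 : ℝ) ≤ γ.sd a + γ.sd b := by positivity
    have h2 : (0 : ℝ) ≤ |(a.length - b.length : ℝ)| := by positivity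
    have h3 : (0 : ℝ) ≤ (p.length : ℝ) + q.length := by positivity
    set s : ℝ := γ.sd a + γ.sd b
    set d : ℝ := |(a.length - b.length : ℝ)|
    have h4 : 0 ≤ k * ((s0 + d0) * (s + d)) := by positivity
    have h5 : 0 ≤ d0 * (s + d) := by positivity
    nlinarith
  refine ⟨2 * k * (s0 + d0 + 1) + 1 + d0, by linarith, ?_⟩
  intro y hy
  rw [space_eq γ (by linarith)] at hy
  induction hy using Submodule.span_induction with
  | zero => simp
  | add x y _ _ h h' =>
    rw [mul_add, add_mul]
    exact ⟨add_mem h.1 h'.1, add_mem h.2 h'.2⟩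
  | smul c x _ h =>
    rw [mul_smul_comm, smul_mul_assoc]
    exact ⟨Submodule.smul_mem _ _ h.1, Submodule.smul_mem _ _ h.2⟩
  | mem x hx =>
    obtain ⟨a, b, h, rfl⟩ := hx
    have h' := key a b h
    constructor
    · apply mul_form_real γ p q a b k (by linarith)
      linarith
    · apply mul_form_real γ a b p q k (by linarith)
      linarith

theorem mulCont_gen (γ : G.Specialization) (x : Gen V E) : MulCont γ (gen F G x) := by
  cases x with
  | vert v =>
    have := mulCont_monomial (F := F) γ ⟨v, [], v, rfl⟩ ⟨v, [], v, rfl⟩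
    simpa [Path.el, Path.star, fwd_nil, bwd_nil, vv] using this
  | edge e =>
    have := mulCont_monomial (F := F) γ ⟨G.s e, [e], G.r e, rfl, rfl⟩ ⟨G.r e, [], G.r e, rfl⟩
    simpa [Path.el, Path.star, fwd_nil, bwd_nil, fwd_cons, se, er] using this
  | ghost e =>
    have := mulCont_monomial (F := F) γ ⟨G.r e, [], G.r e, rfl⟩ ⟨G.s e, [e], G.r e, rfl, rfl⟩
    simpa [Path.el, Path.star, fwd_nil, bwd_nil, bwd_cons, gs, rg] using this

theorem mulCont (γ : G.Specialization) (x : LPA F G) : MulCont γ x := by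
  obtain ⟨x, rfl⟩ := RingQuot.mkAlgHom_surjective F (Rel F G) x
  induction x using FreeAlgebra.induction with
  | grade0 c =>
    intro k hk
    refine ⟨k, hk, fun y hy => ?_⟩
    rw [AlgHom.commutes, ← Algebra.smul_def, ← Algebra.commutes, ← Algebra.smul_def]
    exact ⟨Submodule.smul_mem _ _ hy, Submodule.smul_mem _ _ hy⟩
  | grade1 x => exact mulCont_gen γ x
  | mul a b ha hb =>
    intro k hk
    obtain ⟨k1, hk1, h1⟩ := ha k hk
    obtain ⟨k2, hk2, h2⟩ := hb k1 hk1
    obtain ⟨k3, hk3, h3⟩ := hb k hk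
    obtain ⟨k4, hk4, h4⟩ := ha k3 hk3
    refine ⟨max k2 k4, le_max_of_le_left hk2, fun y hy => ?_⟩
    have hy2 := space_anti γ (by linarith) (le_max_left k2 k4) hy
    have hy4 := space_anti γ (by linarith) (le_max_right k2 k4) hy
    rw [map_mul, mul_assoc, ← mul_assoc y]
    exact ⟨(h1 _ (h2 y hy2).1).1, (h3 _ (h4 y hy4).2).2⟩
  | add a b ha hb =>
    intro k hk
    obtain ⟨k1, hk1, h1⟩ := ha k hk
    obtain ⟨k2, hk2, h2⟩ := hb k hk
    refine ⟨max k1 k2, le_max_of_le_left hk1, fun y hy => ?_⟩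
    have hy1 := h1 y (space_anti γ (by linarith) (le_max_left k1 k2) hy)
    have hy2 := h2 y (space_anti γ (by linarith) (le_max_right k1 k2) hy)
    rw [map_add, add_mul, mul_add]
    exact ⟨add_mem hy1.1 hy2.1, add_mem hy1.2 hy2.2⟩

theorem ringSubgroupsBasis (γ : G.Specialization) :
    RingSubgroupsBasis (fun k : Set.Ici (1 : ℝ) => (γ.space F (k : ℝ)).toAddSubgroup) where
  inter i j := ⟨⟨max i j, Set.mem_Ici.2 (le_max_of_le_left i.2)⟩,
    le_inf (fun _ h => space_anti γ (zero_le_one.trans i.2) (le_max_left _ _) h)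
      (fun _ h => space_anti γ (zero_le_one.trans j.2) (le_max_right _ _) h)⟩
  mul i := ⟨⟨2 * i + 1, by have : (1 : ℝ) ≤ i := i.2; simp; linarith⟩, by
    rintro _ ⟨x, hx, y, hy, rfl⟩
    exact space_mul γ i.2 x hx y hy⟩
  leftMul x i := by
    obtain ⟨k, hk, h⟩ := mulCont γ x i i.2
    exact ⟨⟨k, hk⟩, fun y hy => (h y hy).1⟩
  rightMul x i := by
    obtain ⟨k, hk, h⟩ := mulCont γ x i i.2
    exact ⟨⟨k, hk⟩, fun y hy => (h y hy).2⟩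

end Aux

/-! ### Completions -/

/-- The algebra `L(Γ)`, to be equipped with the topology in which the spaces `V_k`, `k ≥ 1`,
form a basis of neighbourhoods of zero. -/
def TopLPA (_γ : G.Specialization) := LPA F G

variable (γ : G.Specialization)

noncomputable instance : Ring (TopLPA F γ) := inferInstanceAs (Ring (LPA F G))

noncomputable instance : Algebra F (TopLPA F γ) := inferInstanceAs (Algebra F (LPA F G))

/-- The topology with the spaces `V_k`, `k ≥ 1`, as a basis of neighbourhoods of zero. -/
@[reducible] noncomputable def topology : TopologicalSpace (TopLPA F γ) :=
  (ringSubgroupsBasis (F := F) γ).topology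

theorem isTopologicalRing : @IsTopologicalRing (TopLPA F γ) (topology F γ) _ :=
  (ringSubgroupsBasis (F := F) γ).toRingFilterBasis.isTopologicalRing

/-- The additive uniform structure of the topology. -/
noncomputable instance : UniformSpace (TopLPA F γ) :=
  letI := topology F γ
  haveI := isTopologicalRing F γ
  IsTopologicalAddGroup.rightUniformSpace (TopLPA F γ)

instance : IsTopologicalRing (TopLPA F γ) := isTopologicalRing F γ

instance : IsUniformAddGroup (TopLPA F γ) := isUniformAddGroup_of_addCommGroup

theorem hasBasis_nhds_zero :
    (nhds (0 : TopLPA F γ)).HasBasis (fun k : ℝ => 1 ≤ k)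
      (fun k => (γ.space F k : Set (LPA F G))) := by
  have h := (ringSubgroupsBasis (F := F) γ).hasBasis_nhds_zero
  refine ⟨fun t => (h.mem_iff (t := t)).trans ?_⟩
  constructor
  · rintro ⟨i, -, hi⟩; exact ⟨i, i.2, hi⟩
  · rintro ⟨k, hk, hi⟩; exact ⟨⟨k, hk⟩, trivial, hi⟩

instance : UniformContinuousConstSMul F (TopLPA F γ) where
  uniformContinuous_const_smul c := by
    have hc : Continuous (fun x : TopLPA F γ => c • x) := by
      simp only [Algebra.smul_def]
      exact continuous_const.mul continuous_id
    exact uniformContinuous_addMonoidHom_of_continuous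
      (f := DistribSMul.toAddMonoidHom (TopLPA F γ) c) hc

/-- The completion of the topological algebra `L(Γ)`. -/
abbrev Compl := UniformSpace.Completion (TopLPA F γ)

/-- The canonical map from `L(Γ)` to its completion. -/
noncomputable def toCompl (x : LPA F G) : Compl F γ :=
  UniformSpace.Completion.coeRingHom (α := TopLPA F γ) x

theorem toCompl_mul (x y : LPA F G) : toCompl F γ (x * y) = toCompl F γ x * toCompl F γ y :=
  map_mul (UniformSpace.Completion.coeRingHom (α := TopLPA F γ)) x y

theorem toCompl_add (x y : LPA F G) : toCompl F γ (x + y) = toCompl F γ x + toCompl F γ y :=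
  map_add (UniformSpace.Completion.coeRingHom (α := TopLPA F γ)) x y

theorem toCompl_smul (c : F) (x : LPA F G) : toCompl F γ (c • x) = c • toCompl F γ x :=
  UniformSpace.Completion.coe_smul (X := TopLPA F γ) c x

/-- The canonical map from `L(Γ)` to its completion, as a linear map. -/
noncomputable def toComplLin : LPA F G →ₗ[F] Compl F γ where
  toFun := toCompl F γ
  map_add' := toCompl_add F γ
  map_smul' := toCompl_smul F γ

/-- The completion of the homogeneous component `L(Γ)_i` inside the completion of `L(Γ)`. -/
noncomputable def homogCompl (i : ℤ) : Submodule F (Compl F γ) :=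
  ((homog F G i).map (toComplLin F γ)).topologicalClosure

theorem homog_mul {i j : ℤ} {x y : LPA F G} (hx : x ∈ homog F G i) (hy : y ∈ homog F G j) :
    x * y ∈ homog F G (i + j) := by
  refine Submodule.span_induction₂ (p := fun x y _ _ => x * y ∈ homog F G (i + j))
    ?_ ?_ ?_ ?_ ?_ ?_ ?_ hx hy
  · rintro _ _ ⟨l, h, rfl⟩ ⟨l', h', rfl⟩
    exact Submodule.subset_span ⟨l ++ l', by simp [h, h'], by simp⟩
  · intro y _; simp
  · intro x _; simp
  · intro x y z _ _ _ h h'; rw [add_mul]; exact add_mem h h'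
  · intro x y z _ _ _ h h'; rw [mul_add]; exact add_mem h h'
  · intro r x y _ _ h; rw [smul_mul_assoc]; exact Submodule.smul_mem _ _ h
  · intro r x y _ _ h; rw [mul_smul_comm]; exact Submodule.smul_mem _ _ h

theorem homogCompl_mul {i j : ℤ} {x y : Compl F γ} (hx : x ∈ homogCompl F γ i)
    (hy : y ∈ homogCompl F γ j) : x * y ∈ homogCompl F γ (i + j) := by
  refine map_mem_closure₂ (f := fun x y : Compl F γ => x * y) continuous_mul hx hy ?_
  rintro _ ⟨a, ha, rfl⟩ _ ⟨b, hb, rfl⟩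
  exact ⟨a * b, homog_mul F ha hb, toCompl_mul F γ a b⟩

theorem one_mem_homogCompl : (1 : Compl F γ) ∈ homogCompl F γ 0 :=
  subset_closure ⟨1, Submodule.subset_span ⟨[], rfl, rfl⟩,
    map_one (UniformSpace.Completion.coeRingHom (α := TopLPA F γ))⟩

theorem iSup_homogCompl_mul {x y : Compl F γ} (hx : x ∈ ⨆ i, homogCompl F γ i)
    (hy : y ∈ ⨆ i, homogCompl F γ i) : x * y ∈ ⨆ i, homogCompl F γ i := by
  induction hx using Submodule.iSup_induction' with
  | zero => simp
  | add x x' _ _ h h' => rw [add_mul]; exact add_mem h h'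
  | mem i x hx =>
    induction hy using Submodule.iSup_induction' with
    | zero => simp
    | add x x' _ _ h h' => rw [mul_add]; exact add_mem h h'
    | mem j y hy => exact Submodule.mem_iSup_of_mem _ (homogCompl_mul F γ hx hy)

/-- The graded completion of `L(Γ)`: the sum of the completions of the homogeneous components,
as a subalgebra of the completion of `L(Γ)`; it carries the induced topology. -/
noncomputable def gradedCompl : Subalgebra F (Compl F γ) :=
  Submodule.toSubalgebra (⨆ i, homogCompl F γ i)
    (Submodule.mem_iSup_of_mem 0 (one_mem_homogCompl F γ))
    (fun _ _ hx hy => iSup_homogCompl_mul F γ hx hy)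

/-- An ideal of the graded completion is graded if each of its elements is a (finite) sum of
homogeneous elements of the ideal. -/
def IsGradedIdeal (I : TwoSidedIdeal (gradedCompl F γ)) : Prop :=
  ∀ x ∈ I, x ∈ AddSubgroup.closure {y | y ∈ I ∧ ∃ i, (y : Compl F γ) ∈ homogCompl F γ i}

/-- The graded completion is topologically graded simple: it is nonzero, and its only closed
graded (two-sided) ideals are zero and the whole algebra. -/
def IsTopologicallyGradedSimple : Prop :=
  Nontrivial (gradedCompl F γ) ∧
    ∀ I : TwoSidedIdeal (gradedCompl F γ), IsClosed (I : Set (gradedCompl F γ)) →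
      IsGradedIdeal F γ I → I = ⊥ ∨ I = ⊤

end DirGraph

/-- A ring is prime if it is nonzero and the product of two nonzero two-sided ideals
is never zero. -/
def IsPrimeAlgebra (R : Type*) [Ring R] : Prop :=
  Nontrivial R ∧ ∀ I J : TwoSidedIdeal R, (∀ x ∈ I, ∀ y ∈ J, x * y = 0) → I = ⊥ ∨ J = ⊥

/-!
The argument compares `L(Γ)` with rank one projections. From every vertex `u` the special edges
lead along exactly one path, the special path of `u`, which is infinite or stops at a sink. Let
`s_n` be its initial segment of length `n`. The difference of `s_n s_n^*` and `s_{n+1} s_{n+1}^*`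
is a sum of elements `y y^*`, where `y` is a path of length `n + 1` ending in an edge that is not
special. Such elements have `sd(y) = 0` and therefore tend to zero, so `s_n s_n^*` converges to an
idempotent `π_u` of the completion (`tendsto_proj`).

Three properties of these idempotents carry the proof.

* *Density* (`one_mem_of_el_mul_proj_mul_star_mem`). A closed subspace containing `x π x^*` for all
  paths `x`, with `π` taken at the end of `x`, contains `1`. Applied to annihilators, this shows
  that a nonzero element `a` has a nonzero corner `π_u x^* a y π_{u'}`
  (`exists_proj_mul_proj_ne_zero`).
* *Corners are one-dimensional in each degree* (`exists_proj_mul_proj_mem_span`). The product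
  `π_u p q^* π_{u'}` vanishes unless `p` and `q` are initial segments of the special paths of `u`
  and `u'`, and the nonzero products depend only on the degree `l(p) - l(q)`. Hence the nonzero
  corner of a homogeneous element of a closed ideal `I` puts a partial isometry between two special
  paths into `I`, and with it some `π_w` (`exists_proj_mem_idealClosure`).
* *Special paths merge* (`Specialization.IsRegular.merge`). As `L(Γ)` is prime, there is only one
  minimal hereditary set `W`. Regularity forces all special paths into `W`, and any two special
  paths in `W` run into each other, because the graph of special edges in `W` is connected and
  every vertex is the source of at most one of them. If the special paths of `u` and `w` merge, then
  `π_u` and `π_w` generate the same ideal.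

So a nonzero closed graded ideal contains all `π_u`, and by density it contains `1`.

That the completion is nonzero is seen from a representation of `L(Γ)` on the vector space whose
basis consists of the boundary paths that end up following special edges. Its diagonal matrix
coefficient at the special path of a vertex takes the value `1` at `1` and vanishes on `V_1`
(`Specialization.coeff_one`, `Specialization.coeff_eq_zero`).
-/

namespace DirGraph

variable {F : Type*} [Field F] {V E : Type*} {G : DirGraph V E}

/-! ### Operations on paths -/

/-- The path of length `0` at a vertex. -/
def Path.trivial (G : DirGraph V E) (v : V) : G.Path := ⟨v, [], v, rfl⟩

/-- The path `x e`, for an edge `e` starting at the end of the path `x`. -/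
def Path.snoc (x : G.Path) (e : E) (h : G.s e = x.tgt) : G.Path :=
  ⟨x.src, x.edges ++ [e], G.r e, isPath_append.2 ⟨x.tgt, x.isPath, h, rfl⟩⟩

theorem Path.length_snoc (x : G.Path) (e : E) (h : G.s e = x.tgt) :
    (x.snoc e h).length = x.length + 1 := by
  simp [snoc, length]

theorem Specialization.sd_trivial (γ : G.Specialization) (v : V) :
    γ.sd (Path.trivial G v) = 0 := by
  simp [sd, sdList, Path.trivial]

theorem Specialization.sd_snoc_of_not_isSpecial (γ : G.Specialization) (x : G.Path) {e : E}
    (h : G.s e = x.tgt) (he : ¬ γ.IsSpecial e) : γ.sd (x.snoc e h) = 0 := by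
  simp [sd, sdList, Path.snoc, he]

namespace Specialization

variable (γ : G.Specialization)

theorem isSpecial_iff {e : E} (h : ¬ G.IsSink (G.s e)) :
    γ.IsSpecial e ↔ γ.toFun ⟨G.s e, h⟩ = e := by
  constructor
  · rintro ⟨v, rfl⟩
    have : (⟨G.s (γ.toFun v), h⟩ : {v : V // ¬ G.IsSink v}) = v := Subtype.ext (γ.source v)
    rw [this]
  · intro h1; exact ⟨_, h1⟩

theorem isSpecial_toFun {v : V} (h : ¬ G.IsSink v) : γ.IsSpecial (γ.toFun ⟨v, h⟩) := ⟨_, rfl⟩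

open scoped Classical in
/-- The vertex reached from `v` along the special edge starting at `v`; a sink stays where it
is. -/
noncomputable def next (v : V) : V :=
  if h : G.IsSink v then v else G.r (γ.toFun ⟨v, h⟩)

theorem next_of_isSink {v : V} (h : G.IsSink v) : γ.next v = v := dif_pos h

theorem next_of_not_isSink {v : V} (h : ¬ G.IsSink v) :
    γ.next v = G.r (γ.toFun ⟨v, h⟩) := dif_neg h

end Specialization

variable [Fintype V] [Fintype E]

theorem Path.el_trivial (v : V) : (Path.trivial G v).el F = gen F G (.vert v) := by
  simp [el, trivial, fwd_nil]

theorem Path.star_trivial (v : V) : (Path.trivial G v).star F = gen F G (.vert v) := by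
  simp [star, trivial, bwd_nil]

theorem Path.el_snoc (x : G.Path) (e : E) (h : G.s e = x.tgt) :
    (x.snoc e h).el F = x.el F * gen F G (.edge e) := by
  simp [el, snoc, fwd_append, fwd_cons, fwd_nil, mul_assoc]

theorem Path.star_snoc (x : G.Path) (e : E) (h : G.s e = x.tgt) :
    (x.snoc e h).star F = gen F G (.ghost e) * x.star F := by
  simp [star, snoc, bwd_append, bwd_cons, bwd_nil, mul_assoc]

theorem Path.el_mul_tgt (x : G.Path) : x.el F * gen F G (.vert x.tgt) = x.el F :=
  fwd_tgt x.isPath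

theorem Path.tgt_mul_star (x : G.Path) : gen F G (.vert x.tgt) * x.star F = x.star F :=
  bwd_tgt x.isPath

theorem one_eq_sum_vert : (1 : LPA F G) = ∑ v, gen F G (.vert v) := by
  have := gen_eq (Rel.one (F := F) (G := G))
  rw [map_sum, map_one] at this
  exact this.symm

open scoped Classical in
theorem vert_eq_sum_edge_mul_ghost {v : V} (h : ¬ G.IsSink v) :
    gen F G (.vert v) = ∑ e with G.s e = v, gen F G (.edge e) * gen F G (.ghost e) := by
  simpa [gen] using gen_eq (Rel.cuntz_krieger (F := F) (G := G) v h)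

/-! ### Homogeneous components are spanned by the monomials `p q^*` -/

/-- The span of the elements `p q^*` with `l(p) - l(q) = i`. -/
noncomputable def monomialSpan (F : Type*) [Field F] (G : DirGraph V E) (i : ℤ) :
    Submodule F (LPA F G) :=
  Submodule.span F {x | ∃ p q : G.Path, (p.length : ℤ) - q.length = i ∧ x = p.el F * q.star F}

theorem mul_mem_monomialSpan (γ : G.Specialization) {i j : ℤ} {x y : LPA F G}
    (hx : x ∈ monomialSpan F G i) (hy : y ∈ monomialSpan F G j) :
    x * y ∈ monomialSpan F G (i + j) := by
  refine Submodule.span_induction₂ (p := fun x y _ _ => x * y ∈ monomialSpan F G (i + j))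
    ?_ ?_ ?_ ?_ ?_ ?_ ?_ hx hy
  · rintro _ _ ⟨p, q, h, rfl⟩ ⟨p', q', h', rfl⟩
    rcases mul_form (F := F) γ p q p' q' with h0 | ⟨a, b, h0, -, h1, -⟩
    · rw [h0]; exact Submodule.zero_mem _
    · rw [h0]; exact Submodule.subset_span ⟨a, b, by rw [h1, h, h'], rfl⟩
  · intro y _; simp
  · intro x _; simp
  · intro x y z _ _ _ h h'; rw [add_mul]; exact add_mem h h'
  · intro x y z _ _ _ h h'; rw [mul_add]; exact add_mem h h'
  · intro r x y _ _ h; rw [smul_mul_assoc]; exact Submodule.smul_mem _ _ h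
  · intro r x y _ _ h; rw [mul_smul_comm]; exact Submodule.smul_mem _ _ h

theorem vert_mem_monomialSpan (v : V) : gen F G (.vert v) ∈ monomialSpan F G 0 :=
  Submodule.subset_span ⟨Path.trivial G v, Path.trivial G v, by simp,
    by rw [Path.el_trivial, Path.star_trivial, vv]⟩

theorem gen_mem_monomialSpan (x : Gen V E) : gen F G x ∈ monomialSpan F G x.deg := by
  cases x with
  | vert v => exact vert_mem_monomialSpan v
  | edge e =>
    exact Submodule.subset_span ⟨⟨G.s e, [e], G.r e, rfl, rfl⟩, Path.trivial G (G.r e),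
      by simp [Path.length, Path.trivial, Gen.deg],
      by simp [Path.el, Path.star_trivial, fwd_cons, fwd_nil, se, er]⟩
  | ghost e =>
    exact Submodule.subset_span ⟨Path.trivial G (G.r e), ⟨G.s e, [e], G.r e, rfl, rfl⟩,
      by simp [Path.length, Path.trivial, Gen.deg],
      by simp [Path.star, Path.el_trivial, bwd_cons, bwd_nil, gs, rg]⟩

theorem homog_le_monomialSpan (γ : G.Specialization) (i : ℤ) :
    homog F G i ≤ monomialSpan F G i := by
  rw [homog, Submodule.span_le]
  rintro x ⟨l, rfl, rfl⟩
  induction l with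
  | nil =>
    simp only [List.map_nil, List.prod_nil, List.sum_nil]
    rw [one_eq_sum_vert]
    exact Submodule.sum_mem _ fun v _ => vert_mem_monomialSpan v
  | cons a l ih =>
    simp only [List.map_cons, List.prod_cons, List.sum_cons]
    exact mul_mem_monomialSpan γ (gen_mem_monomialSpan a) ih

/-! ### The special path starting at a vertex -/

namespace Specialization

variable (γ : G.Specialization)

open scoped Classical in
/-- The special edge at a vertex `v` as an element of `L(Γ)`; it is `v` itself if `v` is a
sink. -/
noncomputable def stepEl (F : Type*) [Field F] (v : V) : LPA F G :=
  if h : G.IsSink v then gen F G (.vert v) else gen F G (.edge (γ.toFun ⟨v, h⟩))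

open scoped Classical in
/-- The adjoint of `stepEl`. -/
noncomputable def stepStar (F : Type*) [Field F] (v : V) : LPA F G :=
  if h : G.IsSink v then gen F G (.vert v) else gen F G (.ghost (γ.toFun ⟨v, h⟩))

theorem stepEl_of_isSink {v : V} (h : G.IsSink v) : γ.stepEl F v = gen F G (.vert v) := dif_pos h

theorem stepEl_of_not_isSink {v : V} (h : ¬ G.IsSink v) :
    γ.stepEl F v = gen F G (.edge (γ.toFun ⟨v, h⟩)) := dif_neg h

theorem stepStar_of_isSink {v : V} (h : G.IsSink v) :
    γ.stepStar F v = gen F G (.vert v) := dif_pos h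

theorem stepStar_of_not_isSink {v : V} (h : ¬ G.IsSink v) :
    γ.stepStar F v = gen F G (.ghost (γ.toFun ⟨v, h⟩)) := dif_neg h

theorem vert_mul_stepEl (v : V) : gen F G (.vert v) * γ.stepEl F v = γ.stepEl F v := by
  by_cases h : G.IsSink v
  · rw [stepEl_of_isSink γ h, vv]
  · have := se (F := F) (G := G) (γ.toFun ⟨v, h⟩)
    rwa [γ.source, ← stepEl_of_not_isSink] at this

theorem stepEl_mul_vert (v : V) : γ.stepEl F v * gen F G (.vert (γ.next v)) = γ.stepEl F v := by
  by_cases h : G.IsSink v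
  · rw [stepEl_of_isSink γ h, next_of_isSink γ h, vv]
  · rw [stepEl_of_not_isSink γ h, next_of_not_isSink γ h, er]

theorem stepStar_mul_vert (v : V) : γ.stepStar F v * gen F G (.vert v) = γ.stepStar F v := by
  by_cases h : G.IsSink v
  · rw [stepStar_of_isSink γ h, vv]
  · have := gs (F := F) (G := G) (γ.toFun ⟨v, h⟩)
    rwa [γ.source, ← stepStar_of_not_isSink] at this

theorem stepStar_mul_stepEl (v : V) :
    γ.stepStar F v * γ.stepEl F v = gen F G (.vert (γ.next v)) := by
  by_cases h : G.IsSink v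
  · rw [stepStar_of_isSink γ h, stepEl_of_isSink γ h, next_of_isSink γ h, vv]
  · rw [stepStar_of_not_isSink γ h, stepEl_of_not_isSink γ h, next_of_not_isSink γ h, ge]

/-- The special path of length `n` starting at `u`, as an element of `L(Γ)`; the path stops when
it reaches a sink. -/
noncomputable def ray (F : Type*) [Field F] : V → ℕ → LPA F G
  | u, 0 => gen F G (.vert u)
  | u, n + 1 => γ.stepEl F u * ray F (γ.next u) n

/-- The adjoint of `ray`. -/
noncomputable def rayStar (F : Type*) [Field F] : V → ℕ → LPA F G
  | u, 0 => gen F G (.vert u)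
  | u, n + 1 => rayStar F (γ.next u) n * γ.stepStar F u

theorem vert_mul_ray (u : V) (n : ℕ) : gen F G (.vert u) * γ.ray F u n = γ.ray F u n := by
  cases n with
  | zero => exact vv u
  | succ n => rw [ray, ← mul_assoc, vert_mul_stepEl]

theorem rayStar_mul_vert (u : V) (n : ℕ) :
    γ.rayStar F u n * gen F G (.vert u) = γ.rayStar F u n := by
  cases n with
  | zero => exact vv u
  | succ n => rw [rayStar, mul_assoc, stepStar_mul_vert]

theorem ray_add (u : V) (n m : ℕ) :
    γ.ray F u (n + m) = γ.ray F u n * γ.ray F (γ.next^[n] u) m := by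
  induction n generalizing u with
  | zero => simp [ray, vert_mul_ray]
  | succ n ih => rw [add_right_comm, ray, ray, ih, mul_assoc]; rfl

theorem rayStar_add (u : V) (n m : ℕ) :
    γ.rayStar F u (n + m) = γ.rayStar F (γ.next^[n] u) m * γ.rayStar F u n := by
  induction n generalizing u with
  | zero => simp [rayStar, rayStar_mul_vert]
  | succ n ih => rw [add_right_comm, rayStar, rayStar, ih, mul_assoc]; rfl

theorem rayStar_mul_ray (u : V) (n : ℕ) :
    γ.rayStar F u n * γ.ray F u n = gen F G (.vert (γ.next^[n] u)) := by
  induction n generalizing u with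
  | zero => exact vv u
  | succ n ih =>
    rw [ray, rayStar, mul_assoc, ← mul_assoc (γ.stepStar F u), stepStar_mul_stepEl,
      vert_mul_ray, ih]
    rfl

/-- The range projection `s s^*` of the special path `s` of length `n` starting at `u`. -/
noncomputable def rayProj (F : Type*) [Field F] (u : V) (n : ℕ) : LPA F G :=
  γ.ray F u n * γ.rayStar F u n

theorem rayProj_zero (u : V) : γ.rayProj F u 0 = gen F G (.vert u) := vv u

theorem rayProj_succ (u : V) (n : ℕ) :
    γ.rayProj F u (n + 1) = γ.stepEl F u * γ.rayProj F (γ.next u) n * γ.stepStar F u := by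
  simp only [rayProj, ray, rayStar, mul_assoc]

theorem rayProj_of_isSink {u : V} (h : G.IsSink u) (n : ℕ) :
    γ.rayProj F u n = gen F G (.vert u) := by
  induction n with
  | zero => exact rayProj_zero γ u
  | succ n ih =>
    rw [rayProj_succ, next_of_isSink γ h, ih, stepEl_of_isSink γ h, stepStar_of_isSink γ h, vv, vv]

/-- The span of the projections `y y^*`, where `y` is a path of length at least `m` which is
trivial or ends in an edge that is not special. -/
noncomputable def exitSpan (F : Type*) [Field F] (m : ℕ) : Submodule F (LPA F G) :=
  Submodule.span F {a | ∃ y : G.Path, γ.sd y = 0 ∧ m ≤ y.length ∧ a = y.el F * y.star F}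

/-- The paths `y` spanning `exitSpan` have `sd(y) = 0`, so `y y^*` lies in `V_k` as soon as
`k ≤ 2 l(y)`; the cruder condition on `m` suffices. -/
theorem exitSpan_le_space {k : ℝ} {m : ℕ} (hk : 0 ≤ k) (h : k ≤ m) :
    γ.exitSpan F m ≤ γ.space F k := by
  rw [exitSpan, Submodule.span_le, space_eq γ hk]
  rintro _ ⟨y, h0, h1, rfl⟩
  refine Submodule.subset_span ⟨y, y, ?_, rfl⟩
  have : (m : ℝ) ≤ y.length := by exact_mod_cast h1
  simp only [h0, sub_self, abs_zero, Nat.cast_zero, zero_add, mul_one]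
  linarith

open scoped Classical in
/-- Splitting the Cuntz–Krieger sum at the end of `x` into the special and the other edges. -/
theorem el_mul_star_sub_mem_exitSpan (x : G.Path) (h : ¬ G.IsSink x.tgt) :
    x.el F * x.star F - (x.snoc (γ.toFun ⟨x.tgt, h⟩) (γ.source _)).el F *
      (x.snoc (γ.toFun ⟨x.tgt, h⟩) (γ.source _)).star F ∈ γ.exitSpan F (x.length + 1) := by
  have hmem : γ.toFun ⟨x.tgt, h⟩ ∈ Finset.univ.filter (fun e => G.s e = x.tgt) := by
    simp [γ.source]
  have h1 : x.el F * x.star F = x.el F * gen F G (.vert x.tgt) * x.star F := by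
    rw [x.el_mul_tgt]
  rw [h1, vert_eq_sum_edge_mul_ghost h, ← Finset.add_sum_erase _ _ hmem, Path.el_snoc,
    Path.star_snoc, mul_add, add_mul]
  simp only [mul_assoc, add_sub_cancel_left, Finset.mul_sum, Finset.sum_mul]
  refine Submodule.sum_mem _ fun e he => ?_
  rw [Finset.mem_erase, Finset.mem_filter] at he
  obtain ⟨hne, -, he⟩ := he
  refine Submodule.subset_span ⟨x.snoc e he, ?_, (x.length_snoc e he).ge, ?_⟩
  · refine γ.sd_snoc_of_not_isSpecial x he fun hs => hne ?_
    have h2 : ¬ G.IsSink (G.s e) := by rwa [he]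
    rw [isSpecial_iff γ h2] at hs
    rw [← hs]
    congr 2
  · rw [Path.el_snoc, Path.star_snoc, mul_assoc]

/-- Prolonging the special path after `x s_n` by one edge changes its range projection only by
the projections onto the other edges at its end. -/
theorem el_rayProj_sub_mem_exitSpan (x : G.Path) (n : ℕ) :
    x.el F * γ.rayProj F x.tgt n * x.star F - x.el F * γ.rayProj F x.tgt (n + 1) * x.star F
      ∈ γ.exitSpan F (x.length + n + 1) := by
  induction n generalizing x with
  | zero =>
    by_cases h : G.IsSink x.tgt
    · rw [rayProj_of_isSink γ h, rayProj_of_isSink γ h, sub_self]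
      exact Submodule.zero_mem _
    · have := el_mul_star_sub_mem_exitSpan (F := F) γ x h
      rwa [rayProj_succ, rayProj_zero, rayProj_zero, stepEl_mul_vert, stepEl_of_not_isSink γ h,
        stepStar_of_not_isSink γ h, x.el_mul_tgt, ← mul_assoc, ← Path.el_snoc x _ (γ.source _),
        mul_assoc, ← Path.star_snoc x _ (γ.source _)]
  | succ n ih =>
    by_cases h : G.IsSink x.tgt
    · rw [rayProj_of_isSink γ h, rayProj_of_isSink γ h, sub_self]
      exact Submodule.zero_mem _
    · have := ih (x.snoc (γ.toFun ⟨x.tgt, h⟩) (γ.source _))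
      rw [Path.length_snoc, Path.el_snoc, Path.star_snoc] at this
      rw [rayProj_succ _ _ n, rayProj_succ _ _ (n + 1), stepEl_of_not_isSink γ h,
        stepStar_of_not_isSink γ h, next_of_not_isSink γ h]
      simp only [mul_assoc] at this ⊢
      rwa [add_assoc x.length 1 n, add_comm 1 n] at this

theorem el_mul_star_sub_rayProj_mem_exitSpan (x : G.Path) (n : ℕ) :
    x.el F * x.star F - x.el F * γ.rayProj F x.tgt n * x.star F
      ∈ γ.exitSpan F (x.length + 1) := by
  induction n with
  | zero => rw [rayProj_zero, x.el_mul_tgt, sub_self]; exact Submodule.zero_mem _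
  | succ n ih =>
    have h1 : γ.exitSpan F (x.length + n + 1) ≤ γ.exitSpan F (x.length + 1) :=
      Submodule.span_mono fun a ⟨y, hy, hy', h⟩ => ⟨y, hy, by omega, h⟩
    have := add_mem ih (h1 (el_rayProj_sub_mem_exitSpan γ x n))
    rwa [sub_add_sub_cancel] at this

theorem rayProj_sub_mem_exitSpan (u : V) (n : ℕ) :
    γ.rayProj F u n - γ.rayProj F u (n + 1) ∈ γ.exitSpan F (n + 1) := by
  have := el_rayProj_sub_mem_exitSpan (F := F) γ (Path.trivial G u) n
  rw [Path.el_trivial, Path.star_trivial] at this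
  have h : ∀ m, gen F G (.vert u) * γ.rayProj F u m * gen F G (.vert u) = γ.rayProj F u m := by
    intro m
    rw [rayProj, ← mul_assoc, vert_mul_ray, mul_assoc, rayStar_mul_vert]
  simpa [Path.trivial, Path.length, h] using this

end Specialization

end DirGraph

namespace DirGraph

variable {F : Type*} [Field F] {V E : Type*} {G : DirGraph V E}

/-! ### A representation by special tails -/

namespace Specialization

variable (γ : G.Specialization)

/-- `γ.IsTail v l`: the list of edges `l` is a path starting at `v` which is empty or whose last
edge is not special. -/
def IsTail : V → List E → Prop
  | _, [] => True
  | v, e :: l => G.s e = v ∧ IsTail (G.r e) l ∧ (l = [] → ¬ γ.IsSpecial e)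

theorem isTail_nil (v : V) : γ.IsTail v [] := trivial

theorem isTail_cons {e : E} {l : List E} (h : γ.IsTail (G.r e) l)
    (h' : ¬ (l = [] ∧ γ.IsSpecial e)) : γ.IsTail (G.s e) (e :: l) :=
  ⟨rfl, h, fun h1 h2 => h' ⟨h1, h2⟩⟩

/-- The basis of the representation. An element `(v, l)` stands for the boundary path which starts
at `v`, runs through `l`, and from then on follows the special edges (for ever, or up to a sink).
As `l` does not end in a special edge, it is determined by the boundary path. -/
structure Tail where
  src : V
  edges : List E
  isTail : γ.IsTail src edges

/-- The tail at `v` all of whose edges are special. -/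
def Tail.nil (v : V) : γ.Tail := ⟨v, [], γ.isTail_nil v⟩

open scoped Classical in
/-- The partial maps of the set of tails by which the generators act: a vertex restricts to the
tails starting there, an edge is put in front, a ghost edge is removed from the front. -/
noncomputable def act : Gen V E → γ.Tail → Option γ.Tail
  | .vert v, x => if x.src = v then some x else none
  | .edge e, x =>
    if h : G.r e = x.src then
      if h' : x.edges = [] ∧ γ.IsSpecial e then some (Tail.nil γ (G.s e))
      else some ⟨G.s e, e :: x.edges, γ.isTail_cons (h ▸ x.isTail) h'⟩
    else none
  | .ghost e, ⟨v, [], _⟩ =>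
    if G.s e = v ∧ γ.IsSpecial e then some (Tail.nil γ (G.r e)) else none
  | .ghost e, ⟨_, f :: l, h⟩ => if f = e then some ⟨G.r f, l, h.2.1⟩ else none

variable (F) in
/-- The linear map on the free module with basis `X` given by a partial map of `X`. -/
noncomputable def partialLin {X : Type*} (f : X → Option X) : Module.End F (X →₀ F) :=
  Finsupp.linearCombination F fun x => (f x).elim 0 fun y => Finsupp.single y 1

theorem partialLin_single {X : Type*} (f : X → Option X) (x : X) :
    partialLin F f (Finsupp.single x 1) = (f x).elim 0 fun y => Finsupp.single y 1 := by
  simp [partialLin]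

theorem partialLin_mul {X : Type*} (f g : X → Option X) :
    partialLin F f * partialLin F g = partialLin F fun x => (g x).bind f := by
  refine Finsupp.lhom_ext' fun x => LinearMap.ext_ring ?_
  simp only [LinearMap.comp_apply, Finsupp.lsingle_apply, Module.End.mul_apply,
    partialLin_single]
  cases g x with
  | none => simp
  | some y => simp [partialLin_single]

theorem partialLin_eq_zero {X : Type*} {f : X → Option X} (h : ∀ x, f x = none) :
    partialLin F f = 0 := by
  refine Finsupp.lhom_ext' fun x => LinearMap.ext_ring ?_
  simp [partialLin_single, h]

theorem partialLin_mul_eq {X : Type*} {f g k : X → Option X} (h : ∀ x, (g x).bind f = k x) :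
    partialLin F f * partialLin F g = partialLin F k := by
  rw [partialLin_mul]; congr 1; exact funext h

variable (F) in
/-- The action of the free algebra on the module spanned by the tails. -/
noncomputable def freeRep : FreeAlgebra F (Gen V E) →ₐ[F] Module.End F (γ.Tail →₀ F) :=
  FreeAlgebra.lift F fun a => partialLin F (γ.act a)

theorem freeRep_ι (a : Gen V E) :
    γ.freeRep F (FreeAlgebra.ι F a) = partialLin F (γ.act a) := FreeAlgebra.lift_ι_apply _ _

theorem not_isSink_s (e : E) : ¬ G.IsSink (G.s e) := fun h => h e rfl

theorem IsSpecial.eq {γ : G.Specialization} {e f : E} (he : γ.IsSpecial e) (hf : γ.IsSpecial f)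
    (h : G.s e = G.s f) : e = f := by
  obtain ⟨v, rfl⟩ := he
  obtain ⟨w, rfl⟩ := hf
  rw [γ.source, γ.source] at h
  rw [Subtype.ext h]

theorem act_ghost_bind_edge (e : E) (x : γ.Tail) :
    ((γ.act (.ghost e) x).bind (γ.act (.edge e))) =
      if γ.act (.ghost e) x = none then none else some x := by
  obtain ⟨v, l, h⟩ := x
  cases l with
  | nil =>
    by_cases h1 : G.s e = v ∧ γ.IsSpecial e
    · obtain ⟨rfl, h2⟩ := h1
      simp [act, h2, Tail.nil]
    · simp [act, h1]
  | cons f l =>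
    by_cases h1 : f = e
    · subst h1
      have h2 : ¬ (l = [] ∧ γ.IsSpecial f) := fun h3 => h.2.2 h3.1 h3.2
      have h4 : G.s f = v := h.1
      subst h4
      simp [act, h2]
    · simp [act, h1]

theorem act_ghost_ne_none_s {e : E} {x : γ.Tail} (h : γ.act (.ghost e) x ≠ none) :
    G.s e = x.src := by
  obtain ⟨v, l, hx⟩ := x
  cases l with
  | nil =>
    by_contra h1
    exact h (by simp only [act]; rw [if_neg fun h2 => h1 h2.1])
  | cons f l =>
    by_cases h1 : f = e
    · subst h1; exact hx.1
    · exact absurd (by simp [act, h1]) h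

/-- Every tail starting at a vertex that is not a sink has exactly one first edge. -/
theorem existsUnique_act_ghost_ne_none (x : γ.Tail) (h : ¬ G.IsSink x.src) :
    ∃! e, γ.act (.ghost e) x ≠ none := by
  obtain ⟨v, l, hx⟩ := x
  cases l with
  | nil =>
    refine ⟨γ.toFun ⟨v, h⟩, ?_, ?_⟩
    · simp [act, γ.source, γ.isSpecial_toFun]
    · intro e he
      by_cases h1 : G.s e = v ∧ γ.IsSpecial e
      · exact h1.2.eq (γ.isSpecial_toFun h) (h1.1.trans (γ.source ⟨v, h⟩).symm)
      · exact absurd (by simp [act, h1]) he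
  | cons f l =>
    refine ⟨f, by simp [act], fun e he => ?_⟩
    by_contra h1
    exact he (by simp [act, Ne.symm h1])

open scoped Classical in
theorem act_edge_bind_ghost (e f : E) (x : γ.Tail) :
    ((γ.act (.edge f) x).bind (γ.act (.ghost e))) =
      if e = f ∧ G.r e = x.src then some x else none := by
  obtain ⟨v, l, hx⟩ := x
  by_cases h : G.r f = v
  · subst h
    by_cases h' : l = [] ∧ γ.IsSpecial f
    · obtain ⟨rfl, h2⟩ := h'
      by_cases hef : e = f
      · subst hef; simp [act, h2, Tail.nil]
      · have : ¬ (G.s e = G.s f ∧ γ.IsSpecial e) := fun h3 => hef (h3.2.eq h2 h3.1)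
        simp [act, h2, Tail.nil, hef, this]
    · by_cases hef : e = f
      · subst hef; simp [act, h']
      · simp [act, h', hef, Ne.symm hef]
  · have : ¬ (e = f ∧ G.r e = v) := by rintro ⟨rfl, h1⟩; exact h h1
    simp [act, h, this]

theorem act_edge_eq_some_s {e : E} {x y : γ.Tail} (h : γ.act (.edge e) x = some y) :
    y.src = G.s e := by
  simp only [act] at h
  split_ifs at h <;> cases h <;> rfl

theorem act_ghost_eq_some_r {e : E} {x y : γ.Tail} (h : γ.act (.ghost e) x = some y) :
    y.src = G.r e := by
  obtain ⟨v, l, hx⟩ := x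
  cases l with
  | nil =>
    simp only [act] at h
    split_ifs at h; cases h; rfl
  | cons f l =>
    simp only [act] at h
    split_ifs at h with h1; cases h; exact congrArg G.r h1

theorem sd_eq_length {p : G.Path} (h : ∀ e ∈ p.edges, γ.IsSpecial e) : γ.sd p = p.length := by
  classical
  rw [sd, sdList, Path.length, List.rtakeWhile_eq_self_iff.2 (by simpa using h)]

variable [Fintype V] [Fintype E]

theorem freeRep_rel {a b : FreeAlgebra F (Gen V E)} (h : Rel F G a b) :
    γ.freeRep F a = γ.freeRep F b := by
  classical
  induction h with
  | one =>
    rw [map_sum, map_one]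
    refine Finsupp.lhom_ext' fun x => LinearMap.ext_ring ?_
    simp only [LinearMap.comp_apply, Finsupp.lsingle_apply, LinearMap.sum_apply, freeRep_ι,
      partialLin_single, Module.End.one_apply]
    rw [Finset.sum_eq_single x.src (fun v _ hv => by simp [act, Ne.symm hv]) (by simp)]
    simp [act]
  | vert_mul_self v =>
    rw [map_mul, freeRep_ι]
    refine partialLin_mul_eq fun x => ?_
    by_cases h : x.src = v <;> simp [act, h]
  | vert_mul_vert v w h =>
    rw [map_mul, freeRep_ι, freeRep_ι, partialLin_mul, map_zero]
    refine partialLin_eq_zero fun x => ?_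
    by_cases h1 : x.src = w
    · simp [act, h1, Ne.symm h]
    · simp [act, h1]
  | source_mul_edge e =>
    rw [map_mul, freeRep_ι, freeRep_ι]
    refine partialLin_mul_eq fun x => ?_
    cases h : γ.act (.edge e) x with
    | none => rfl
    | some y => simp [act, act_edge_eq_some_s γ h]
  | edge_mul_range e =>
    rw [map_mul, freeRep_ι, freeRep_ι]
    refine partialLin_mul_eq fun x => ?_
    by_cases h : G.r e = x.src
    · simp [act, h]
    · simp [act, h, Ne.symm h]
  | range_mul_ghost e =>
    rw [map_mul, freeRep_ι, freeRep_ι]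
    refine partialLin_mul_eq fun x => ?_
    cases h : γ.act (.ghost e) x with
    | none => rfl
    | some y => simp [act, act_ghost_eq_some_r γ h]
  | ghost_mul_source e =>
    rw [map_mul, freeRep_ι, freeRep_ι]
    refine partialLin_mul_eq fun x => ?_
    by_cases h : x.src = G.s e
    · simp [act, h]
    · have : γ.act (.ghost e) x = none := by
        by_contra h1
        exact h (act_ghost_ne_none_s γ h1).symm
      rw [this]
      simp [act, h]
  | ghost_mul_self e =>
    rw [map_mul, freeRep_ι, freeRep_ι, freeRep_ι]
    refine partialLin_mul_eq fun x => ?_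
    rw [act_edge_bind_ghost]
    simp [act, eq_comm]
  | ghost_mul_edge e f h =>
    rw [map_mul, freeRep_ι, freeRep_ι, partialLin_mul, map_zero]
    refine partialLin_eq_zero fun x => ?_
    rw [act_edge_bind_ghost]
    simp [h]
  | cuntz_krieger v hv =>
    rw [map_sum]
    simp only [map_mul, freeRep_ι, partialLin_mul, act_ghost_bind_edge]
    refine Finsupp.lhom_ext' fun x => LinearMap.ext_ring ?_
    simp only [LinearMap.comp_apply, Finsupp.lsingle_apply, LinearMap.sum_apply,
      partialLin_single]
    by_cases h : x.src = v
    · subst h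
      obtain ⟨e, he, hu⟩ := γ.existsUnique_act_ghost_ne_none x hv
      rw [Finset.sum_eq_single e]
      · simp only [he]; simp [act]
      · intro f _ hf
        have : γ.act (.ghost f) x = none := by
          by_contra h1
          exact hf (hu f h1)
        simp [this]
      · intro h1
        exact absurd (by simpa using act_ghost_ne_none_s γ he) h1
    · rw [Finset.sum_eq_zero]
      · simp [act, h]
      · intro e he
        have : γ.act (.ghost e) x = none := by
          by_contra h1
          exact h ((act_ghost_ne_none_s γ h1).symm.trans (by simpa using he))
        simp [this]

variable (F) in
/-- The representation of `L(Γ)` on the module spanned by the tails. -/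
noncomputable def rep : LPA F G →ₐ[F] Module.End F (γ.Tail →₀ F) :=
  RingQuot.liftAlgHom F ⟨γ.freeRep F, fun _ _ h => freeRep_rel γ h⟩

theorem rep_gen (a : Gen V E) : γ.rep F (gen F G a) = partialLin F (γ.act a) := by
  rw [rep, gen, RingQuot.liftAlgHom_mkAlgHom_apply, freeRep_ι]

variable (F) in
/-- The diagonal matrix coefficient of the representation at the special tail starting at `v`. -/
noncomputable def coeff (v : V) : LPA F G →ₗ[F] F :=
  Finsupp.lapply (Tail.nil γ v) ∘ₗ LinearMap.applyₗ (Finsupp.single (Tail.nil γ v) 1) ∘ₗ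
    (γ.rep F).toLinearMap

theorem coeff_apply (v : V) (a : LPA F G) : γ.coeff F v a =
    γ.rep F a (Finsupp.single (Tail.nil γ v) 1) (Tail.nil γ v) := rfl

open scoped Classical in
theorem coeff_vert (v w : V) : γ.coeff F v (gen F G (.vert w)) = if v = w then 1 else 0 := by
  rw [coeff_apply, rep_gen, partialLin_single]
  by_cases h : v = w <;> simp [act, Tail.nil, h]

theorem vert_ne_zero (γ : G.Specialization) (v : V) : gen F G (.vert v) ≠ 0 := by
  classical
  intro h
  have := coeff_vert (F := F) γ v v
  simp [h] at this

theorem coeff_one (v : V) : γ.coeff F v 1 = 1 := by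
  classical
  rw [one_eq_sum_vert, map_sum]
  simp [coeff_vert]

/-- The adjoint of a path which is not special kills the special tails. -/
theorem rep_bwd_single_nil {l : List E} (h : ∃ e ∈ l, ¬ γ.IsSpecial e) (v : V) :
    γ.rep F (bwd F l) (Finsupp.single (Tail.nil γ v) 1) = 0 := by
  induction l generalizing v with
  | nil => simp at h
  | cons e l ih =>
    rw [bwd_cons, map_mul, Module.End.mul_apply, rep_gen, partialLin_single]
    by_cases he : G.s e = v ∧ γ.IsSpecial e
    · have h1 : ∃ e ∈ l, ¬ γ.IsSpecial e := by
        obtain ⟨f, hf, hf'⟩ := h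
        rcases List.mem_cons.1 hf with rfl | hf
        · exact absurd he.2 hf'
        · exact ⟨f, hf, hf'⟩
      simp only [Tail.nil, act, he, and_self, if_true, Option.elim_some]
      exact ih h1 _
    · simp [Tail.nil, act, he]

open scoped Classical in
theorem rep_vert_apply_nil (w v : V) (m : γ.Tail →₀ F) :
    γ.rep F (gen F G (.vert w)) m (Tail.nil γ v) = if v = w then m (Tail.nil γ v) else 0 := by
  induction m using Finsupp.induction_linear with
  | zero => simp
  | add m m' h h' => rw [map_add, Finsupp.add_apply, h, h', Finsupp.add_apply]; split_ifs <;> simp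
  | single x c =>
    rw [← mul_one c, ← smul_eq_mul, ← Finsupp.smul_single, map_smul, Finsupp.smul_apply,
      Finsupp.smul_apply, rep_gen, partialLin_single]
    by_cases h : v = w
    · by_cases h' : x.src = w
      · simp [act, h, h']
      · have : x ≠ Tail.nil γ w := fun hx => h' (by rw [hx, Tail.nil])
        simp [act, h, h', this.symm]
    · by_cases h' : x.src = w
      · have : x ≠ Tail.nil γ v := fun hx => h (by rw [← h', hx, Tail.nil])
        simp [act, h, h', this.symm]
      · simp [act, h, h']

open scoped Classical in
theorem rep_edge_apply_nil (e : E) (v : V) (m : γ.Tail →₀ F) :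
    γ.rep F (gen F G (.edge e)) m (Tail.nil γ v) =
      if G.s e = v ∧ γ.IsSpecial e then m (Tail.nil γ (G.r e)) else 0 := by
  induction m using Finsupp.induction_linear with
  | zero => simp
  | add m m' h h' => rw [map_add, Finsupp.add_apply, h, h', Finsupp.add_apply]; split_ifs <;> simp
  | single x c =>
    obtain ⟨w, l, hx⟩ := x
    rw [← mul_one c, ← smul_eq_mul, ← Finsupp.smul_single, map_smul, Finsupp.smul_apply,
      Finsupp.smul_apply, rep_gen, partialLin_single]
    by_cases h : G.r e = w
    · subst h
      by_cases h' : l = [] ∧ γ.IsSpecial e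
      · obtain ⟨rfl, he⟩ := h'
        by_cases hv : G.s e = v <;> simp [act, he, hv, Tail.nil]
      · by_cases hl : l = []
        · subst hl
          have he : ¬ γ.IsSpecial e := fun he => h' ⟨rfl, he⟩
          simp [act, he, Tail.nil]
        · simp [act, hl, Tail.nil]
    · simp [act, h, Tail.nil]

/-- The range of a path which is not special has no component at the special tails. -/
theorem rep_fwd_apply_nil {l : List E} (h : ∃ e ∈ l, ¬ γ.IsSpecial e) (v : V)
    (m : γ.Tail →₀ F) : γ.rep F (fwd F l) m (Tail.nil γ v) = 0 := by
  classical
  induction l generalizing v with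
  | nil => simp at h
  | cons e l ih =>
    rw [fwd_cons, map_mul, Module.End.mul_apply, rep_edge_apply_nil]
    split_ifs with he
    · refine ih ?_ _
      obtain ⟨f, hf, hf'⟩ := h
      rcases List.mem_cons.1 hf with rfl | hf
      · exact absurd he.2 hf'
      · exact ⟨f, hf, hf'⟩
    · rfl

/-- A monomial `p q^*` in `V_1` cannot consist of special edges only, so its matrix coefficient
at the special tails vanishes. -/
theorem coeff_eq_zero (v : V) {a : LPA F G} (ha : a ∈ γ.space F 1) : γ.coeff F v a = 0 := by
  rw [space_eq γ zero_le_one] at ha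
  induction ha using Submodule.span_induction with
  | zero => exact map_zero _
  | add x y _ _ h h' => rw [map_add, h, h', add_zero]
  | smul c x _ h => rw [map_smul, h, smul_zero]
  | mem x hx =>
    classical
    obtain ⟨p, q, h, rfl⟩ := hx
    by_cases hp : ∀ e ∈ p.edges, γ.IsSpecial e
    · by_cases hq : ∀ e ∈ q.edges, γ.IsSpecial e
      · rw [sd_eq_length γ hp, sd_eq_length γ hq] at h
        have := abs_nonneg (p.length - q.length : ℝ)
        linarith
      · push Not at hq
        rw [coeff_apply, Path.star]
        simp only [map_mul, Module.End.mul_apply]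
        rw [rep_gen _ (.vert _), partialLin_single]
        by_cases h1 : v = q.src
        · have h2 : γ.act (.vert q.src) (Tail.nil γ v) = some (Tail.nil γ v) := if_pos h1
          rw [h2, Option.elim_some, rep_bwd_single_nil γ hq, map_zero, Finsupp.zero_apply]
        · have h2 : γ.act (.vert q.src) (Tail.nil γ v) = none := if_neg h1
          rw [h2, Option.elim_none, map_zero, map_zero, Finsupp.zero_apply]
    · push Not at hp
      rw [coeff_apply, Path.el]
      simp only [map_mul, Module.End.mul_apply]
      rw [rep_vert_apply_nil]
      split_ifs
      · exact rep_fwd_apply_nil γ hp _ _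
      · rfl

end Specialization
end DirGraph

namespace DirGraph

variable {F : Type*} [Field F] {V E : Type*} {G : DirGraph V E}

/-! ### Special paths run into each other -/

theorem singleton_mem_frame {v : V} (h : G.IsSink v) : {v} ∈ G.frame := by
  refine ⟨⟨Set.singleton_nonempty v, ?_⟩, ?_⟩
  · rintro w rfl u ⟨⟨a, l, b, hp⟩, rfl, rfl⟩
    cases l with
    | nil => exact Eq.symm hp
    | cons e l => exact absurd hp.1 (h e)
  · rintro W hW hWv w rfl
    obtain ⟨x, hx⟩ := hW.1
    have : x = w := hWv hx
    rwa [← this]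

theorem IsHereditary.inter {W W' : Set V} (h : G.IsHereditary W) (h' : G.IsHereditary W')
    (hn : (W ∩ W').Nonempty) : G.IsHereditary (W ∩ W') :=
  ⟨hn, fun w hw u hu => ⟨h.2 w hw.1 u hu, h'.2 w hw.2 u hu⟩⟩

/-- If `a R b = 0`, then the left annihilator of `R b` and the right annihilator of that ideal are
two-sided ideals with product zero, containing `a` and `b`. -/
theorem exists_mul_mul_ne_zero {R : Type*} [Ring R] (hR : IsPrimeAlgebra R) {a b : R}
    (ha : a ≠ 0) (hb : b ≠ 0) : ∃ c, a * c * b ≠ 0 := by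
  by_contra! h
  let I : TwoSidedIdeal R := TwoSidedIdeal.mk' {x | ∀ c, x * c * b = 0}
    (by simp)
    (fun {x y} hx hy c => by rw [add_mul, add_mul, hx c, hy c, add_zero])
    (fun {x} hx c => by rw [neg_mul, neg_mul, hx c, neg_zero])
    (fun {x y} hy c => by rw [mul_assoc, mul_assoc, ← mul_assoc y, hy c, mul_zero])
    (fun {x y} hx c => by rw [mul_assoc x]; exact hx _)
  let J : TwoSidedIdeal R := TwoSidedIdeal.mk' {y | ∀ x ∈ I, x * y = 0}
    (by simp)
    (fun {x y} hx hy c hc => by rw [mul_add, hx c hc, hy c hc, add_zero])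
    (fun {x} hx c hc => by rw [mul_neg, hx c hc, neg_zero])
    (fun {x y} hy c hc => by rw [← mul_assoc]; exact hy _ (I.mul_mem_right _ _ hc))
    (fun {x y} hx c hc => by rw [← mul_assoc, hx c hc, zero_mul])
  have hI : ∀ x, x ∈ I ↔ ∀ c, x * c * b = 0 := fun x => TwoSidedIdeal.mem_mk' ..
  have hJ : ∀ y, y ∈ J ↔ ∀ x ∈ I, x * y = 0 := fun y => TwoSidedIdeal.mem_mk' ..
  rcases hR.2 I J fun x hx y hy => (hJ y).1 hy x hx with h0 | h0
  · exact ha (by rw [← TwoSidedIdeal.mem_bot, ← h0, hI]; exact h)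
  · refine hb ?_
    rw [← TwoSidedIdeal.mem_bot, ← h0, hJ]
    intro x hx
    simpa using (hI x).1 hx 1

namespace Specialization

variable (γ : G.Specialization)

theorem exists_special_path (n : ℕ) (u : V) (h : ∀ i, ¬ G.IsSink (γ.next^[i] u)) :
    ∃ p : G.Path, p.src = u ∧ p.length = n ∧ (∀ e ∈ p.edges, γ.IsSpecial e) ∧
      ∀ v ∈ p.vertices, ∃ i, v = γ.next^[i] u := by
  induction n generalizing u with
  | zero => exact ⟨Path.trivial G u, rfl, rfl, by simp [Path.trivial],
      by simpa [Path.vertices, Path.trivial] using ⟨0, rfl⟩⟩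
  | succ n ih =>
    have h0 : ¬ G.IsSink u := h 0
    obtain ⟨⟨a, l, b, hp⟩, rfl, hl, hs, hv⟩ := ih (γ.next u) fun i => h (i + 1)
    refine ⟨⟨u, γ.toFun ⟨u, h0⟩ :: l, b, γ.source _, ?_⟩, rfl, ?_, ?_, ?_⟩
    · rwa [← next_of_not_isSink γ h0]
    · simpa [Path.length] using hl
    · intro e he
      rcases List.mem_cons.1 he with rfl | he
      · exact γ.isSpecial_toFun h0
      · exact hs e he
    · intro v hv'
      simp only [Path.vertices, List.map_cons, List.mem_cons] at hv' hv
      rcases hv' with rfl | rfl | hv'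
      · exact ⟨0, rfl⟩
      · exact ⟨1, (next_of_not_isSink γ h0).symm⟩
      · obtain ⟨i, hi⟩ := hv v (Or.inr hv')
        exact ⟨i + 1, hi⟩

/-- Otherwise the initial segments of the special path would be infinitely many special paths
outside the minimal hereditary sets; sinks cannot occur, as they form such sets themselves. -/
theorem IsRegular.exists_iterate_mem_frame {γ : G.Specialization} (hγ : γ.IsRegular) (u : V) :
    ∃ n, ∃ W ∈ G.frame, γ.next^[n] u ∈ W := by
  by_contra! h
  have h0 : ∀ n, γ.next^[n] u ∉ ⋃₀ G.frame := by
    rintro n ⟨W, hW, hn⟩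
    exact h n W hW hn
  have hs : ∀ n, ¬ G.IsSink (γ.next^[n] u) := fun n hn => h n _ (singleton_mem_frame hn) rfl
  refine (Set.Ici_infinite 1).mono ?_ (hγ.finite_special.image Path.length)
  intro n hn
  obtain ⟨p, -, hl, hp, hv⟩ := γ.exists_special_path n u hs
  refine ⟨p, ⟨⟨hl.symm ▸ hn, hp⟩, fun v hv' => ?_⟩, hl⟩
  obtain ⟨i, rfl⟩ := hv v hv'
  exact h0 i

/-- Two vertices merge if the special paths starting at them run into each other. -/
def Merge (u v : V) : Prop := ∃ n m, γ.next^[n] u = γ.next^[m] v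

theorem Merge.symm {γ : G.Specialization} {u v : V} (h : γ.Merge u v) : γ.Merge v u := by
  obtain ⟨n, m, h⟩ := h
  exact ⟨m, n, h.symm⟩

theorem Merge.trans {γ : G.Specialization} {u v w : V} (h : γ.Merge u v) (h' : γ.Merge v w) :
    γ.Merge u w := by
  obtain ⟨n, m, h⟩ := h
  obtain ⟨n', m', h'⟩ := h'
  refine ⟨n' + n, m + m', ?_⟩
  rw [Function.iterate_add_apply, h, Function.iterate_add_apply _ m m', ← h',
    ← Function.iterate_add_apply, ← Function.iterate_add_apply, add_comm]

theorem merge_of_special {e : E} (he : γ.IsSpecial e) : γ.Merge (G.s e) (G.r e) := by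
  have h : ¬ G.IsSink (G.s e) := not_isSink_s e
  refine ⟨1, 0, ?_⟩
  simp [next_of_not_isSink γ h, (isSpecial_iff γ h).1 he]

/-- A special edge joins a vertex to the next vertex of its special path, and merging is an
equivalence relation. -/
theorem IsRegular.merge_of_mem {γ : G.Specialization} (hγ : γ.IsRegular) {W : Set V}
    (hW : W ∈ G.frame) {u v : V} (hu : u ∈ W) (hv : v ∈ W) : γ.Merge u v := by
  obtain ⟨p⟩ := (hγ.connected W hW).preconnected ⟨u, hu⟩ ⟨v, hv⟩
  suffices h : ∀ (a b : W), (γ.undirected W).Walk a b → γ.Merge a b from h _ _ p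
  intro a b p
  induction p with
  | nil => exact ⟨0, 0, rfl⟩
  | cons hab _ ih =>
    refine Merge.trans ?_ ih
    rw [undirected, SimpleGraph.fromRel_adj] at hab
    obtain ⟨-, ⟨e, he, h1, h2⟩ | ⟨e, he, h1, h2⟩⟩ := hab
    · rw [← h1, ← h2]; exact γ.merge_of_special he
    · rw [← h1, ← h2]; exact (γ.merge_of_special he).symm

end Specialization

variable [Fintype V] [Fintype E]

theorem gen_mem_homog (a : Gen V E) : gen F G a ∈ homog F G a.deg :=
  Submodule.subset_span ⟨[a], by simp, by simp⟩

/-- `L(Γ)` is the sum of its homogeneous components. -/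
theorem iSup_homog : ⨆ i, homog F G i = ⊤ := by
  rw [eq_top_iff]
  rintro b -
  have hmul : ∀ x ∈ ⨆ i, homog F G i, ∀ y ∈ ⨆ i, homog F G i, x * y ∈ ⨆ i, homog F G i := by
    intro x hx y hy
    induction hx using Submodule.iSup_induction' with
    | zero => simp
    | add x x' _ _ h h' => rw [add_mul]; exact add_mem h h'
    | mem i x hx =>
      induction hy using Submodule.iSup_induction' with
      | zero => simp
      | add x x' _ _ h h' => rw [mul_add]; exact add_mem h h'
      | mem j y hy => exact Submodule.mem_iSup_of_mem _ (homog_mul F hx hy)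
  obtain ⟨b, rfl⟩ := RingQuot.mkAlgHom_surjective F (Rel F G) b
  induction b using FreeAlgebra.induction with
  | grade0 c =>
    rw [AlgHom.commutes, Algebra.algebraMap_eq_smul_one]
    exact Submodule.smul_mem _ _
      (Submodule.mem_iSup_of_mem 0 (Submodule.subset_span ⟨[], rfl, rfl⟩))
  | grade1 a => exact Submodule.mem_iSup_of_mem _ (gen_mem_homog a)
  | mul a b ha hb => rw [map_mul]; exact hmul _ ha _ hb
  | add a b ha hb => rw [map_add]; exact add_mem ha hb

/-- Vertices without a common descendant are not connected by elements of `L(Γ)`. -/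
theorem vert_mul_vert_eq_zero (γ : G.Specialization) {w w' : V}
    (h : ∀ u, G.Descendant w u → ¬ G.Descendant w' u) (b : LPA F G) :
    gen F G (.vert w) * b * gen F G (.vert w') = 0 := by
  have hb : b ∈ ⨆ i, homog F G i := by rw [iSup_homog]; trivial
  induction hb using Submodule.iSup_induction' with
  | zero => simp
  | add x x' _ _ h h' => rw [mul_add, add_mul, h, h', add_zero]
  | mem i x hx =>
    replace hx := homog_le_monomialSpan γ i hx
    induction hx using Submodule.span_induction with
    | zero => simp
    | add x x' _ _ h h' => rw [mul_add, add_mul, h, h', add_zero]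
    | smul c x _ h => rw [mul_smul_comm, smul_mul_assoc, h, smul_zero]
    | mem x hx =>
      obtain ⟨p, q, -, rfl⟩ := hx
      by_cases hp : w = p.src
      · by_cases hq : q.src = w'
        · have ht : p.tgt ≠ q.tgt := fun ht => h p.tgt ⟨p, hp.symm, rfl⟩ ⟨q, hq, ht.symm⟩
          rw [← p.el_mul_tgt, ← q.tgt_mul_star, mul_assoc (p.el F), ← mul_assoc _ _ (q.star F),
            vw ht, zero_mul, mul_zero, mul_zero, zero_mul]
        · rw [Path.star, mul_assoc, mul_assoc, mul_assoc (bwd F q.edges), vw hq, mul_zero,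
            mul_zero, mul_zero]
      · rw [Path.el, ← mul_assoc, ← mul_assoc, vw hp, zero_mul, zero_mul, zero_mul]

/-- If `L(Γ)` is prime, any two vertices have a common descendant. -/
theorem exists_common_descendant (hprime : IsPrimeAlgebra (LPA F G)) (γ : G.Specialization)
    (w w' : V) : ∃ u, G.Descendant w u ∧ G.Descendant w' u := by
  by_contra! h
  obtain ⟨b, hb⟩ := exists_mul_mul_ne_zero hprime (γ.vert_ne_zero (F := F) w)
    (γ.vert_ne_zero (F := F) w')
  exact hb (vert_mul_vert_eq_zero γ h b)

/-- If `L(Γ)` is prime, there is only one minimal hereditary subset. -/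
theorem frame_subsingleton (hprime : IsPrimeAlgebra (LPA F G)) (γ : G.Specialization) :
    G.frame.Subsingleton := by
  intro W hW W' hW'
  obtain ⟨w, hw⟩ := hW.1.1
  obtain ⟨w', hw'⟩ := hW'.1.1
  obtain ⟨u, hu, hu'⟩ := exists_common_descendant hprime γ w w'
  have hi := hW.1.inter hW'.1 ⟨u, hW.1.2 w hw u hu, hW'.1.2 w' hw' u hu'⟩
  exact (hW.eq_of_le hi Set.inter_subset_left).symm.trans
    (hW'.eq_of_le hi Set.inter_subset_right)

theorem Specialization.IsRegular.merge (hprime : IsPrimeAlgebra (LPA F G))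
    {γ : G.Specialization} (hγ : γ.IsRegular) (u v : V) : γ.Merge u v := by
  obtain ⟨n, W, hW, hn⟩ := hγ.exists_iterate_mem_frame u
  obtain ⟨m, W', hW', hm⟩ := hγ.exists_iterate_mem_frame v
  obtain rfl := frame_subsingleton hprime γ hW hW'
  have h1 : γ.Merge u (γ.next^[n] u) := ⟨n, 0, rfl⟩
  have h2 : γ.Merge v (γ.next^[m] v) := ⟨m, 0, rfl⟩
  exact (h1.trans (hγ.merge_of_mem hW hn hm)).trans h2.symm

end DirGraph

namespace DirGraph

open Filter Topology

variable {F : Type*} [Field F] {V E : Type*} [Fintype V] [Fintype E] {G : DirGraph V E}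

namespace Specialization

theorem vert_mul_rayStar (γ : G.Specialization) (u : V) (n : ℕ) :
    gen F G (.vert (γ.next^[n] u)) * γ.rayStar F u n = γ.rayStar F u n := by
  have h := rayStar_add (F := F) γ u n 0
  exact h.symm

theorem rayProj_mul_self (γ : G.Specialization) (u : V) (n : ℕ) :
    γ.rayProj F u n * γ.rayProj F u n = γ.rayProj F u n := by
  rw [rayProj, mul_assoc, ← mul_assoc (γ.rayStar F u n), rayStar_mul_ray, vert_mul_rayStar]

end Specialization

variable (F) (γ : G.Specialization)

/-! ### The topology of the completion -/

/-- The closure of the space `V_k` in the completion. -/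
noncomputable def nbhd (k : ℝ) : Submodule F (Compl F γ) :=
  ((γ.space F k).map (toComplLin F γ)).topologicalClosure

theorem hasBasis_nhds_zero_compl :
    (𝓝 (0 : Compl F γ)).HasBasis (fun k : ℝ => 1 ≤ k) (fun k => (nbhd F γ k : Set (Compl F γ))) :=
  (hasBasis_nhds_zero F γ).hasBasis_of_isDenseInducing UniformSpace.Completion.isDenseInducing_coe

variable {F}

theorem toCompl_zero : toCompl F γ 0 = 0 := (toComplLin F γ).map_zero

theorem toCompl_one : toCompl F γ 1 = 1 :=
  map_one (UniformSpace.Completion.coeRingHom (α := TopLPA F γ))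

theorem toCompl_mem_nbhd {k : ℝ} {x : LPA F G} (h : x ∈ γ.space F k) :
    toCompl F γ x ∈ nbhd F γ k := subset_closure ⟨x, h, rfl⟩

theorem nbhd_anti {k k' : ℝ} (hk : 0 ≤ k) (h : k ≤ k') : nbhd F γ k' ≤ nbhd F γ k :=
  Submodule.topologicalClosure_mono (Submodule.map_mono (space_anti γ hk h))

theorem mem_closure_compl_iff {s : Set (Compl F γ)} {x : Compl F γ} :
    x ∈ closure s ↔ ∀ k : ℝ, 1 ≤ k → ∃ y ∈ s, y - x ∈ nbhd F γ k := by
  have h : (𝓝 x).HasBasis (fun k : ℝ => 1 ≤ k)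
      (fun k => (fun y => y - x) ⁻¹' (nbhd F γ k : Set (Compl F γ))) := by
    rw [← nhds_translation_sub]
    exact (hasBasis_nhds_zero_compl F γ).comap _
  rw [mem_closure_iff_nhds_basis h]
  rfl

/-- Only elements of the intersection of the spaces `V_k` become zero in the completion. -/
theorem toCompl_ne_zero {x : LPA F G} {k : ℝ} (hk : 1 ≤ k) (h : x ∉ γ.space F k) :
    toCompl F γ x ≠ 0 := by
  intro h0
  have h1 := (hasBasis_nhds_zero F γ).mem_of_mem hk
  rw [(UniformSpace.Completion.isUniformInducing_coe (TopLPA F γ)).isInducing.nhds_eq_comap]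
    at h1
  obtain ⟨t, ht, h2⟩ := Filter.mem_comap.1 h1
  refine h (h2 ?_)
  have h3 : toCompl F γ x ∈ t := by rw [h0]; exact mem_of_mem_nhds ht
  exact h3

theorem denseRange_toCompl : DenseRange (toCompl F γ) :=
  UniformSpace.Completion.denseRange_coe (α := TopLPA F γ)

/-- The limit of the projections `s s^*`, where `s` runs through the initial segments of the
special path starting at `u`. In the representation by tails it is the rank one projection onto
the special tail starting at `u`. -/
noncomputable def proj (u : V) : Compl F γ :=
  limUnder atTop fun n => toCompl F γ (γ.rayProj F u n)

theorem tendsto_proj (u : V) :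
    Tendsto (fun n => toCompl F γ (γ.rayProj F u n)) atTop (𝓝 (proj γ u)) := by
  refine CauchySeq.tendsto_limUnder ?_
  have h : CauchySeq (α := TopLPA F γ) (fun n => γ.rayProj F u n) := by
    have : NonarchimedeanRing (TopLPA F γ) := (ringSubgroupsBasis (F := F) γ).nonarchimedean
    refine NonarchimedeanAddGroup.cauchySeq_of_tendsto_sub_nhds_zero ?_
    rw [(hasBasis_nhds_zero F γ).tendsto_right_iff]
    intro k hk
    filter_upwards [eventually_ge_atTop ⌈k⌉₊] with n hn
    refine sub_mem_comm_iff.1 (γ.exitSpan_le_space (by linarith) ?_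
      (γ.rayProj_sub_mem_exitSpan u n))
    have := Nat.ceil_le.1 hn
    push_cast
    linarith
  exact h.map (UniformSpace.Completion.uniformContinuous_coe _)

theorem proj_eq_step (u : V) : proj γ u =
    toCompl F γ (γ.stepEl F u) * proj γ (γ.next u) * toCompl F γ (γ.stepStar F u) := by
  refine tendsto_nhds_unique ((tendsto_add_atTop_iff_nat 1).2 (tendsto_proj γ u)) ?_
  simp only [γ.rayProj_succ, toCompl_mul]
  exact ((tendsto_proj γ _).const_mul _).mul_const _

theorem proj_mul_self (u : V) : proj (F := F) γ u * proj γ u = proj γ u := by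
  refine tendsto_nhds_unique ((tendsto_proj γ u).mul (tendsto_proj γ u)) ?_
  simp only [← toCompl_mul, γ.rayProj_mul_self]
  exact tendsto_proj γ u

theorem vert_mul_proj (u : V) : toCompl F γ (gen F G (.vert u)) * proj γ u = proj γ u := by
  rw [proj_eq_step, ← mul_assoc, ← mul_assoc, ← toCompl_mul, γ.vert_mul_stepEl]

theorem proj_mul_vert (u : V) : proj γ u * toCompl F γ (gen F G (.vert u)) = proj γ u := by
  rw [proj_eq_step, mul_assoc, ← toCompl_mul, γ.stepStar_mul_vert]

theorem proj_eq_ray (u : V) (n : ℕ) : proj γ u =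
    toCompl F γ (γ.ray F u n) * proj γ (γ.next^[n] u) * toCompl F γ (γ.rayStar F u n) := by
  induction n generalizing u with
  | zero =>
    rw [Specialization.ray, Specialization.rayStar, Function.iterate_zero_apply, vert_mul_proj,
      proj_mul_vert]
  | succ n ih =>
    rw [proj_eq_step, ih, Specialization.ray, Specialization.rayStar, toCompl_mul, toCompl_mul,
      Function.iterate_succ_apply]
    simp only [mul_assoc]

theorem rayStar_mul_proj_mul_ray (u : V) (n : ℕ) :
    toCompl F γ (γ.rayStar F u n) * proj γ u * toCompl F γ (γ.ray F u n) =
      proj γ (γ.next^[n] u) := by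
  rw [proj_eq_ray γ u n, ← mul_assoc, ← mul_assoc, ← toCompl_mul, γ.rayStar_mul_ray,
    vert_mul_proj, mul_assoc, ← toCompl_mul, γ.rayStar_mul_ray, proj_mul_vert]

/-! ### Density of the ideal generated by the limit projections -/

/-- A closed subspace containing all `x π x^*`, where `π` is the limit projection at the end of the
path `x`, contains `1`: each `x x^*` is the limit of `x π x^*` plus sums of `y y^*`, where `y`
extends `x` and ends in an edge which is not special. Repeating this, the lengths of the paths `y`
grow while `sd(y) = 0`, so the error terms tend to zero. -/
theorem one_mem_of_el_mul_proj_mul_star_mem {J : Submodule F (Compl F γ)}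
    (hJ : IsClosed (J : Set (Compl F γ)))
    (h : ∀ x : G.Path, toCompl F γ (x.el F) * proj γ x.tgt * toCompl F γ (x.star F) ∈ J) :
    1 ∈ J := by
  rw [← SetLike.mem_coe, ← hJ.closure_eq, mem_closure_compl_iff]
  intro k hk
  suffices h1 : (1 : Compl F γ) ∈ J ⊔ nbhd F γ k by
    obtain ⟨y, hy, z, hz, h2⟩ := Submodule.mem_sup.1 h1
    exact ⟨y, hy, by rw [← h2, sub_add_cancel_left]; exact neg_mem hz⟩
  -- Downward induction on the length of `x`: if `k ≤ l(x)`, then `x x^*` lies in `V_k`.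
  have key : ∀ N : ℕ, ∀ x : G.Path, γ.sd x = 0 → k ≤ x.length + N →
      toCompl F γ (x.el F * x.star F) ∈ J ⊔ nbhd F γ k := by
    intro N
    induction N with
    | zero =>
      intro x hx hk'
      refine Submodule.mem_sup_right (toCompl_mem_nbhd γ ?_)
      exact γ.exitSpan_le_space (by linarith) (by simpa using hk')
        (Submodule.subset_span ⟨x, hx, le_rfl, rfl⟩)
    | succ N ih =>
      intro x hx hk'
      have ht : toCompl F γ (x.el F) * proj γ x.tgt * toCompl F γ (x.star F) ∈
          closure (Set.range fun n => toCompl F γ (x.el F * γ.rayProj F x.tgt n * x.star F)) := by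
        refine mem_closure_of_tendsto (f := fun n =>
          toCompl F γ (x.el F * γ.rayProj F x.tgt n * x.star F)) (b := atTop) ?_
          (Eventually.of_forall fun n => ⟨n, rfl⟩)
        simp only [toCompl_mul]
        exact ((tendsto_proj γ _).const_mul _).mul_const _
      obtain ⟨_, ⟨n, rfl⟩, hn⟩ := (mem_closure_compl_iff γ).1 ht k hk
      have h2 : ∀ a ∈ γ.exitSpan F (x.length + 1), toCompl F γ a ∈ J ⊔ nbhd F γ k := by
        intro a ha
        have : γ.exitSpan F (x.length + 1) ≤ (J ⊔ nbhd F γ k).comap (toComplLin F γ) := by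
          rw [Specialization.exitSpan, Submodule.span_le]
          rintro _ ⟨y, hy, hl, rfl⟩
          refine ih y hy (hk'.trans ?_)
          have : ((x.length + 1 : ℕ) : ℝ) ≤ y.length := by exact_mod_cast hl
          push_cast at this ⊢
          linarith
        exact this ha
      have h3 := add_mem (h2 _ (γ.el_mul_star_sub_rayProj_mem_exitSpan x n))
        (add_mem (Submodule.mem_sup_right hn) (Submodule.mem_sup_left (h x)))
      rwa [sub_add_cancel, ← toCompl_add, sub_add_cancel] at h3
  have h1 : (1 : Compl F γ) = ∑ v, toCompl F γ (gen F G (.vert v)) := by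
    have := congrArg (toComplLin F γ) (one_eq_sum_vert (F := F) (G := G))
    rw [map_sum] at this
    exact (toCompl_one γ).symm.trans this
  rw [h1]
  refine Submodule.sum_mem _ fun v _ => ?_
  have := key ⌈k⌉₊ (Path.trivial G v) (γ.sd_trivial v) ((Nat.le_ceil k).trans (by simp))
  rwa [Path.el_trivial, Path.star_trivial, vv] at this

/-! ### Corners cut out by the limit projections -/

/-- The limit projection at `u` kills every path which is not special. -/
theorem proj_mul_fwd {l : List E} {u w : V} (h : G.IsPath u l w) :
    proj γ u * toCompl F γ (gen F G (.vert u) * fwd F l) = 0 ∨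
      (γ.next^[l.length] u = w ∧ proj γ u * toCompl F γ (gen F G (.vert u) * fwd F l) =
        toCompl F γ (γ.ray F u l.length) * proj γ w) := by
  induction l generalizing u with
  | nil =>
    cases h
    refine Or.inr ⟨rfl, ?_⟩
    rw [fwd_nil, List.length_nil, Specialization.ray, vert_mul_proj, mul_one, proj_mul_vert]
  | cons e l ih =>
    obtain ⟨rfl, h⟩ := h
    have hs := Specialization.not_isSink_s (G := G) e
    rw [fwd_cons, ← mul_assoc, se, ← er e, mul_assoc, toCompl_mul, ← mul_assoc, proj_eq_step,
      mul_assoc (_ * _) _ (toCompl F γ (gen F G (.edge e))), ← toCompl_mul,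
      γ.stepStar_of_not_isSink hs]
    by_cases he : γ.toFun ⟨G.s e, hs⟩ = e
    · have hn : γ.next (G.s e) = G.r e := by rw [γ.next_of_not_isSink hs, he]
      rw [he, ge, hn, mul_assoc _ (proj γ _), proj_mul_vert, mul_assoc]
      rcases ih h with h0 | ⟨h0, h1⟩
      · left; rw [h0, mul_zero]
      · refine Or.inr ⟨by rw [List.length_cons, Function.iterate_succ_apply, hn, h0], ?_⟩
        rw [h1, List.length_cons, Specialization.ray, hn, toCompl_mul, mul_assoc]
    · left
      rw [gf he, toCompl_zero, mul_zero, zero_mul]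

theorem bwd_mul_proj {l : List E} {u w : V} (h : G.IsPath u l w) :
    toCompl F γ (bwd F l * gen F G (.vert u)) * proj γ u = 0 ∨
      (γ.next^[l.length] u = w ∧ toCompl F γ (bwd F l * gen F G (.vert u)) * proj γ u =
        proj γ w * toCompl F γ (γ.rayStar F u l.length)) := by
  induction l generalizing u with
  | nil =>
    cases h
    refine Or.inr ⟨rfl, ?_⟩
    rw [bwd_nil, List.length_nil, Specialization.rayStar, one_mul, vert_mul_proj, proj_mul_vert]
  | cons e l ih =>
    obtain ⟨rfl, h⟩ := h
    have hs := Specialization.not_isSink_s (G := G) e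
    rw [bwd_cons, mul_assoc, gs, ← rg e, ← mul_assoc, toCompl_mul, mul_assoc,
      proj_eq_step, ← mul_assoc (toCompl F γ (gen F G _)), ← mul_assoc (toCompl F γ (gen F G _)),
      ← toCompl_mul, γ.stepEl_of_not_isSink hs]
    by_cases he : e = γ.toFun ⟨G.s e, hs⟩
    · have hn : γ.next (G.s e) = G.r e := by rw [γ.next_of_not_isSink hs, ← he]
      rw [← he, ge, hn, vert_mul_proj, ← mul_assoc]
      rcases ih h with h0 | ⟨h0, h1⟩
      · left; rw [h0, zero_mul]
      · refine Or.inr ⟨by rw [List.length_cons, Function.iterate_succ_apply, hn, h0], ?_⟩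
        rw [h1, List.length_cons, Specialization.rayStar, hn, toCompl_mul, mul_assoc]
    · left
      rw [gf he, toCompl_zero, zero_mul, zero_mul, mul_zero]

/-- The partial isometry from the special tail starting at `u'` to the one starting at `u` which
matches the `m`-th vertex of the former with the `n`-th vertex of the latter. -/
noncomputable def tailMatch (F : Type*) [Field F] (γ : G.Specialization) (u u' : V) (n m : ℕ) :
    Compl F γ :=
  toCompl F γ (γ.ray F u n) * proj γ (γ.next^[n] u) * toCompl F γ (γ.rayStar F u' m)

theorem tailMatchadd (u u' : V) {n m : ℕ} (h : γ.next^[n] u = γ.next^[m] u') (j : ℕ) :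
    tailMatch F γ u u' (n + j) (m + j) = tailMatch F γ u u' n m := by
  rw [tailMatch, tailMatch, γ.ray_add, γ.rayStar_add, proj_eq_ray γ (γ.next^[n] u) j, ← h,
    toCompl_mul, toCompl_mul, add_comm n j, Function.iterate_add_apply]
  simp only [mul_assoc]

/-- `tailMatch` only depends on the degree `n - m`. -/
theorem tailMatcheq (u u' : V) {n m n' m' : ℕ} (h : γ.next^[n] u = γ.next^[m] u')
    (h' : γ.next^[n'] u = γ.next^[m'] u') (hd : (n : ℤ) - m = n' - m') :
    tailMatch F γ u u' n m = tailMatch F γ u u' n' m' := by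
  rcases le_total n n' with hn | hn
  · obtain ⟨j, rfl⟩ := Nat.exists_eq_add_of_le hn
    obtain rfl : m' = m + j := by omega
    exact (tailMatchadd γ u u' h j).symm
  · obtain ⟨j, rfl⟩ := Nat.exists_eq_add_of_le hn
    obtain rfl : m = m' + j := by omega
    exact tailMatchadd γ u u' h' j

theorem proj_mul_monomial_mul_proj (u u' : V) (p q : G.Path) :
    proj γ u * toCompl F γ (p.el F * q.star F) * proj γ u' = 0 ∨
      ∃ n m : ℕ, (n : ℤ) - m = p.length - q.length ∧ γ.next^[n] u = γ.next^[m] u' ∧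
        proj γ u * toCompl F γ (p.el F * q.star F) * proj γ u' = tailMatch F γ u u' n m := by
  by_cases hu : u = p.src
  swap
  · left
    rw [← proj_mul_vert γ u, mul_assoc (proj γ u), ← toCompl_mul, Path.el, ← mul_assoc,
      ← mul_assoc, vw hu, zero_mul, zero_mul, toCompl_zero, mul_zero, zero_mul]
  by_cases hu' : q.src = u'
  swap
  · left
    rw [← vert_mul_proj γ u', mul_assoc (proj γ u), ← mul_assoc (toCompl F γ _), ← toCompl_mul,
      Path.star, mul_assoc, mul_assoc, vw hu', mul_zero, mul_zero, toCompl_zero, zero_mul, mul_zero]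
  by_cases ht : p.tgt = q.tgt
  swap
  · left
    rw [← p.el_mul_tgt, ← q.tgt_mul_star, mul_assoc (p.el F), ← mul_assoc _ _ (q.star F),
      vw ht, zero_mul, mul_zero, toCompl_zero, mul_zero, zero_mul]
  subst hu hu'
  rw [toCompl_mul, ← mul_assoc, mul_assoc]
  rcases proj_mul_fwd (F := F) γ p.isPath with h | ⟨h1, h2⟩
  · left; rw [Path.el, h, zero_mul]
  rcases bwd_mul_proj (F := F) γ q.isPath with h | ⟨h3, h4⟩
  · left; rw [Path.star, h, mul_zero]
  refine Or.inr ⟨p.length, q.length, rfl, h1.trans (ht.trans h3.symm), ?_⟩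
  rw [Path.el, h2, Path.star, h4, tailMatch, ← ht, Path.length, h1, mul_assoc,
    ← mul_assoc (proj γ _), proj_mul_self, mul_assoc]
  rfl

/-- The corner between two limit projections is one-dimensional in each degree. -/
theorem exists_proj_mul_proj_mem_span (u u' : V) (d : ℤ) : ∃ z : Compl F γ,
    (z = 0 ∨ ∃ n m : ℕ, γ.next^[n] u = γ.next^[m] u' ∧ z = tailMatch F γ u u' n m) ∧
      ∀ a ∈ monomialSpan F G d,
        proj γ u * toCompl F γ a * proj γ u' ∈ Submodule.span F {z} := by
  have lin : ∀ z : Compl F γ, (∀ p q : G.Path, (p.length : ℤ) - q.length = d →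
      proj γ u * toCompl F γ (p.el F * q.star F) * proj γ u' ∈ Submodule.span F {z}) →
      ∀ a ∈ monomialSpan F G d,
        proj γ u * toCompl F γ a * proj γ u' ∈ Submodule.span F {z} := by
    intro z hz a ha
    induction ha using Submodule.span_induction with
    | zero =>
      rw [toCompl_zero, mul_zero, zero_mul]
      exact Submodule.zero_mem _
    | add x y _ _ h h' => rw [toCompl_add, mul_add, add_mul]; exact add_mem h h'
    | smul c x _ h =>
      rw [toCompl_smul, mul_smul_comm, smul_mul_assoc]
      exact Submodule.smul_mem _ _ h
    | mem x hx =>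
      obtain ⟨p, q, h, rfl⟩ := hx
      exact hz p q h
  by_cases h : ∃ n m : ℕ, (n : ℤ) - m = d ∧ γ.next^[n] u = γ.next^[m] u'
  · obtain ⟨n, m, hd, h⟩ := h
    refine ⟨_, Or.inr ⟨n, m, h, rfl⟩, lin _ fun p q hpq => ?_⟩
    rcases proj_mul_monomial_mul_proj (F := F) γ u u' p q with h0 | ⟨n', m', hd', h', h0⟩
    · rw [h0]; exact Submodule.zero_mem _
    · rw [h0, tailMatcheq γ u u' h' h (by omega)]
      exact Submodule.mem_span_singleton_self _
  · refine ⟨0, Or.inl rfl, lin _ fun p q hpq => ?_⟩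
    rcases proj_mul_monomial_mul_proj (F := F) γ u u' p q with h0 | ⟨n', m', hd', h', h0⟩
    · rw [h0]; exact Submodule.zero_mem _
    · exact absurd ⟨n', m', hd'.trans hpq, h'⟩ h

/-- As the neighbourhoods of zero are subspaces, a nonzero limit `b` of multiples of `z` is
approximated by `c z` with `c ≠ 0`, and then `c⁻¹ b` approximates `z` equally well. -/
theorem mem_of_mem_closure_span {J : Submodule F (Compl F γ)}
    (hJ : IsClosed (J : Set (Compl F γ))) {b z : Compl F γ} (hb : b ∈ J) (hb0 : b ≠ 0)
    (hbz : b ∈ closure (Submodule.span F {z} : Set (Compl F γ))) : z ∈ J := by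
  obtain ⟨k, hk, hbk⟩ : ∃ k : ℝ, 1 ≤ k ∧ b ∉ nbhd F γ k := by
    obtain ⟨k, hk, h⟩ := (hasBasis_nhds_zero_compl F γ).mem_iff.1
      (isOpen_compl_singleton.mem_nhds hb0.symm)
    exact ⟨k, hk, fun h1 => h h1 rfl⟩
  rw [← SetLike.mem_coe, ← hJ.closure_eq, mem_closure_compl_iff]
  intro k' hk'
  obtain ⟨y, hy, hyb⟩ := (mem_closure_compl_iff γ).1 hbz (max k k') (hk.trans (le_max_left _ _))
  obtain ⟨c, rfl⟩ := Submodule.mem_span_singleton.1 hy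
  have hc : c ≠ 0 := by
    rintro rfl
    rw [zero_smul, zero_sub, neg_mem_iff] at hyb
    exact hbk (nbhd_anti γ (by linarith) (le_max_left _ _) hyb)
  refine ⟨c⁻¹ • b, J.smul_mem _ hb, nbhd_anti γ (by linarith) (le_max_right k k') ?_⟩
  have := (nbhd F γ (max k k')).smul_mem (-c⁻¹) hyb
  rwa [smul_sub, smul_smul, neg_mul, inv_mul_cancel₀ hc, neg_smul, neg_smul, one_smul,
    neg_sub_neg] at this

end DirGraph

namespace DirGraph

open Filter Topology

variable {F : Type*} [Field F] {V E : Type*} [Fintype V] [Fintype E] {G : DirGraph V E}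
  (γ : G.Specialization)

/-! ### Closed graded ideals -/

theorem mem_gradedCompl_iff {x : Compl F γ} :
    x ∈ gradedCompl F γ ↔ x ∈ ⨆ i, homogCompl F γ i := Iff.rfl

theorem toCompl_mem_gradedCompl (a : LPA F G) : toCompl F γ a ∈ gradedCompl F γ := by
  rw [mem_gradedCompl_iff]
  have ha : a ∈ ⨆ i, homog F G i := by rw [iSup_homog]; trivial
  induction ha using Submodule.iSup_induction' with
  | zero => rw [toCompl_zero]; exact Submodule.zero_mem _
  | add x y _ _ h h' => rw [toCompl_add]; exact add_mem h h'
  | mem i x hx => exact Submodule.mem_iSup_of_mem i (subset_closure ⟨x, hx, rfl⟩)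

variable {γ}

/-- The closure in the completion of an ideal of the graded completion. -/
noncomputable def idealClosure (I : TwoSidedIdeal (gradedCompl F γ)) : Submodule F (Compl F γ) :=
  Submodule.topologicalClosure
    { carrier := Subtype.val '' (I : Set (gradedCompl F γ))
      zero_mem' := ⟨0, I.zero_mem, rfl⟩
      add_mem' := by
        rintro _ _ ⟨x, hx, rfl⟩ ⟨y, hy, rfl⟩
        exact ⟨x + y, I.add_mem hx hy, rfl⟩
      smul_mem' := by
        rintro c _ ⟨x, hx, rfl⟩
        refine ⟨c • x, ?_, rfl⟩
        rw [Algebra.smul_def]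
        exact I.mul_mem_left _ _ hx }

theorem isClosed_idealClosure (I : TwoSidedIdeal (gradedCompl F γ)) :
    IsClosed (idealClosure I : Set (Compl F γ)) :=
  Submodule.isClosed_topologicalClosure _

theorem coe_mem_idealClosure {I : TwoSidedIdeal (gradedCompl F γ)} {x : gradedCompl F γ}
    (hx : x ∈ I) : (x : Compl F γ) ∈ idealClosure I :=
  subset_closure ⟨x, hx, rfl⟩

/-- A closed ideal is recovered from its closure in the completion. -/
theorem mem_of_coe_mem_idealClosure {I : TwoSidedIdeal (gradedCompl F γ)}
    (hI : IsClosed (I : Set (gradedCompl F γ))) {x : gradedCompl F γ}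
    (hx : (x : Compl F γ) ∈ idealClosure I) : x ∈ I := by
  have h : x ∈ closure (I : Set (gradedCompl F γ)) := closure_subtype.2 hx
  rwa [hI.closure_eq] at h

/-- The closure of an ideal of the graded completion is an ideal of the whole completion, as the
image of `L(Γ)` is dense. -/
theorem mul_mem_idealClosure {I : TwoSidedIdeal (gradedCompl F γ)} (c : Compl F γ)
    {x : Compl F γ} (hx : x ∈ idealClosure I) : c * x ∈ idealClosure I := by
  refine map_mem_closure₂ (f := fun x y : Compl F γ => x * y) continuous_mul
    (denseRange_toCompl γ c) hx ?_
  rintro _ ⟨a, rfl⟩ _ ⟨y, hy, rfl⟩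
  exact ⟨⟨_, toCompl_mem_gradedCompl γ a⟩ * y, I.mul_mem_left _ _ hy, rfl⟩

theorem mem_mul_idealClosure {I : TwoSidedIdeal (gradedCompl F γ)} (c : Compl F γ)
    {x : Compl F γ} (hx : x ∈ idealClosure I) : x * c ∈ idealClosure I := by
  refine map_mem_closure₂ (f := fun x y : Compl F γ => x * y) continuous_mul hx
    (denseRange_toCompl γ c) ?_
  rintro _ ⟨y, hy, rfl⟩ _ ⟨a, rfl⟩
  exact ⟨y * ⟨_, toCompl_mem_gradedCompl γ a⟩, I.mul_mem_right _ _ hy, rfl⟩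

/-- The two-sided annihilator conditions are closed, so by density of the ideal generated by the
limit projections, some corner of a nonzero element does not vanish. -/
theorem exists_proj_mul_proj_ne_zero {y : Compl F γ} (hy : y ≠ 0) : ∃ p q : G.Path,
    proj γ p.tgt * (toCompl F γ (p.star F) * y * toCompl F γ (q.el F)) * proj γ q.tgt ≠ 0 := by
  by_contra! h
  have h1 : ∀ p : G.Path, proj γ p.tgt * (toCompl F γ (p.star F) * y) = 0 := by
    intro p
    set y' := proj γ p.tgt * (toCompl F γ (p.star F) * y) with hy'
    have : (1 : Compl F γ) ∈ LinearMap.ker (LinearMap.mulLeft F y') := by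
      refine one_mem_of_el_mul_proj_mul_star_mem γ ?_ fun q => ?_
      · exact isClosed_eq (continuous_const.mul continuous_id) continuous_const
      · rw [LinearMap.mem_ker, LinearMap.mulLeft_apply, ← mul_assoc, ← mul_assoc]
        have := h p q
        rw [← mul_assoc (proj γ p.tgt), ← hy'] at this
        rw [this, zero_mul]
    simpa using this
  have : (1 : Compl F γ) ∈ LinearMap.ker (LinearMap.mulRight F y) := by
    refine one_mem_of_el_mul_proj_mul_star_mem γ ?_ fun p => ?_
    · exact isClosed_eq (continuous_id.mul continuous_const) continuous_const
    · rw [LinearMap.mem_ker, LinearMap.mulRight_apply, mul_assoc, mul_assoc, h1, mul_zero]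
  exact hy (by simpa using this)

theorem star_mem_monomialSpan (p : G.Path) : p.star F ∈ monomialSpan F G (-p.length) :=
  Submodule.subset_span ⟨Path.trivial G p.tgt, p, by simp [Path.trivial, Path.length],
    by rw [Path.el_trivial, p.tgt_mul_star]⟩

theorem el_mem_monomialSpan (p : G.Path) : p.el F ∈ monomialSpan F G p.length :=
  Submodule.subset_span ⟨p, Path.trivial G p.tgt, by simp [Path.trivial, Path.length],
    by rw [Path.star_trivial, p.el_mul_tgt]⟩

/-- A nonzero homogeneous element of an ideal puts some limit projection into the closure of the
ideal. -/
theorem exists_proj_mem_idealClosure {I : TwoSidedIdeal (gradedCompl F γ)} {y : Compl F γ}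
    {d : ℤ} (hy : y ∈ idealClosure I) (hy0 : y ≠ 0) (hd : y ∈ homogCompl F γ d) :
    ∃ w, proj γ w ∈ idealClosure I := by
  obtain ⟨p, q, hpq⟩ := exists_proj_mul_proj_ne_zero hy0
  obtain ⟨z, hz, hspan⟩ := exists_proj_mul_proj_mem_span (F := F) γ p.tgt q.tgt
    (-p.length + d + q.length)
  have hb := mem_mul_idealClosure (proj γ q.tgt) (mul_mem_idealClosure (proj γ p.tgt)
    (mem_mul_idealClosure (toCompl F γ (q.el F))
      (mul_mem_idealClosure (toCompl F γ (p.star F)) hy)))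
  have hbz : proj γ p.tgt * (toCompl F γ (p.star F) * y * toCompl F γ (q.el F)) * proj γ q.tgt ∈
      closure (Submodule.span F {z} : Set (Compl F γ)) := by
    let f : Compl F γ → Compl F γ := fun y => proj γ p.tgt *
      (toCompl F γ (p.star F) * y * toCompl F γ (q.el F)) * proj γ q.tgt
    have hf : Continuous f :=
      (continuous_const.mul ((continuous_const.mul continuous_id).mul continuous_const)).mul
        continuous_const
    change f y ∈ _
    refine map_mem_closure (f := f) (x := y) hf hd ?_
    rintro _ ⟨a, ha, rfl⟩
    have := hspan _ (mul_mem_monomialSpan γ (mul_mem_monomialSpan γ (star_mem_monomialSpan p)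
      (homog_le_monomialSpan γ d ha)) (el_mem_monomialSpan q))
    rw [toCompl_mul, toCompl_mul] at this
    exact this
  have hzI := mem_of_mem_closure_span γ (isClosed_idealClosure I) hb hpq hbz
  rcases hz with rfl | ⟨n, m, hnm, rfl⟩
  · refine absurd ?_ hpq
    simpa using hbz
  · refine ⟨γ.next^[n] p.tgt, ?_⟩
    have := mem_mul_idealClosure (toCompl F γ (γ.ray F q.tgt m))
      (mul_mem_idealClosure (toCompl F γ (γ.rayStar F p.tgt n)) hzI)
    rwa [tailMatch, ← mul_assoc, ← mul_assoc, ← toCompl_mul, γ.rayStar_mul_ray, vert_mul_proj,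
      mul_assoc, ← toCompl_mul, γ.rayStar_mul_ray, ← hnm, proj_mul_vert] at this

/-- Limit projections at vertices whose special paths merge generate the same ideal. -/
theorem proj_mem_idealClosure_of_merge {I : TwoSidedIdeal (gradedCompl F γ)} {u w : V}
    (h : γ.Merge u w) (hw : proj γ w ∈ idealClosure I) : proj γ u ∈ idealClosure I := by
  obtain ⟨n, m, h⟩ := h
  rw [proj_eq_ray γ u n, h, ← rayStar_mul_proj_mul_ray]
  exact mem_mul_idealClosure _ (mul_mem_idealClosure _
    (mem_mul_idealClosure _ (mul_mem_idealClosure _ hw)))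

theorem nontrivial_gradedCompl (hprime : IsPrimeAlgebra (LPA F G)) (γ : G.Specialization) :
    Nontrivial (gradedCompl F γ) := by
  have hV : Nonempty V := by
    by_contra hV
    rw [not_nonempty_iff] at hV
    have := hprime.1
    exact one_ne_zero (α := LPA F G) (by rw [one_eq_sum_vert, Fintype.sum_empty])
  obtain ⟨v⟩ := hV
  refine ⟨1, 0, fun h => toCompl_ne_zero (F := F) (G := G) γ (x := 1) le_rfl ?_ ?_⟩
  · intro h1
    have := γ.coeff_eq_zero v h1
    rw [γ.coeff_one] at this
    exact one_ne_zero this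
  · rw [toCompl_one]
    exact congrArg Subtype.val h

theorem eq_top_of_isGradedIdeal (hγ : ∀ u v, γ.Merge u v) {I : TwoSidedIdeal (gradedCompl F γ)}
    (hI : IsClosed (I : Set (gradedCompl F γ))) (hg : IsGradedIdeal F γ I) (h0 : I ≠ ⊥) :
    I = ⊤ := by
  obtain ⟨y, hy, d, hd, hy0⟩ : ∃ y ∈ I, ∃ d, (y : Compl F γ) ∈ homogCompl F γ d ∧ y ≠ 0 := by
    by_contra! h
    refine h0 (le_bot_iff.1 fun x hx => ?_)
    have h1 : AddSubgroup.closure {y | y ∈ I ∧ ∃ i, (y : Compl F γ) ∈ homogCompl F γ i} ≤ ⊥ := by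
      rw [AddSubgroup.closure_le]
      rintro y ⟨hy, d, hd⟩
      exact h y hy d hd
    rw [TwoSidedIdeal.mem_bot]
    exact h1 (hg x hx)
  obtain ⟨w, hw⟩ := exists_proj_mem_idealClosure (coe_mem_idealClosure hy)
    (fun h => hy0 (Subtype.ext h)) hd
  rw [← TwoSidedIdeal.one_mem_iff]
  refine mem_of_coe_mem_idealClosure hI ?_
  exact one_mem_of_el_mul_proj_mul_star_mem γ (isClosed_idealClosure I) fun x =>
    mem_mul_idealClosure _ (mul_mem_idealClosure _ (proj_mem_idealClosure_of_merge (hγ _ w) hw))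

end DirGraph

theorem mainTheorem3 {V E : Type*} [Fintype V] [Fintype E] (F : Type*) [Field F]
    (Γ : DirGraph V E) (hprime : IsPrimeAlgebra (DirGraph.LPA F Γ))
    (γ : Γ.Specialization) (hγ : γ.IsRegular) :
    DirGraph.IsTopologicallyGradedSimple F γ := by
  refine ⟨DirGraph.nontrivial_gradedCompl hprime γ, fun I hI hg => ?_⟩
  by_cases h : I = ⊥
  · exact Or.inl h
  · exact Or.inr (DirGraph.eq_top_of_isGradedIdeal (hγ.merge hprime) hI hg h)
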